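/- **Theorem 1.** Fix $\alpha\in(0,2]$ and $\kappa>0$. We write $S_\alpha(\sigma,\beta,\mu)$ ($\sigma\ge 0$, $\beta\in[-1,1]$, $\mu\in\mathbb R$) for the stable law with characteristic function $\theta\mapsto\exp\{\sigma^\alpha(-|\theta|^\alpha+i\theta\,\omega(\theta,\alpha,\beta))+i\mu\theta\}$, where $\omega(\theta,\alpha,\beta)=\beta|\theta|^{\alpha-1}\tan\frac{\pi\alpha}{2}$ if $\alpha\ne1$ and $\omega(\theta,1,\beta)=-\frac{2}{\pi}\beta\ln|\theta|$. Let $L$ be the Laplacian of a connected simple undirected graph on $n$ nodes with positive symmetric link weights, and let $L=Q\Lambda Q^T$ with $Q=(q_{ij})$ orthogonal and $\Lambda=\mathrm{diag}(\lambda_1,\dots,\lambda_n)$, $0=\lambda_1<\lambda_2\le\dots\le\lambda_n$. Let $Z_1,\dots,Z_n$ be independent $\alpha$-stable random measures on $[0,\infty)$ with control measure $m(ds)=\kappa\,ds$ and constant skewness intensities $\beta_1,\dots,\beta_n\in[-1,1]$. That is, each $Z_j$ is independently scattered, is $\sigma$-additive (almost surely, for each sequence of disjoint sets), and satisfies $Z_j(A)\sim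 S_\alpha(m(A)^{1/\alpha},\beta_j,0)$ for every Borel set $A$ with $m(A)<\infty$. Put $dz=(Z_1(ds),\dots,Z_n(ds))^T$. For a deterministic $x_0\in\mathbb R^n$ let $$x_t=e^{-Lt}x_0+\int_0^te^{-L(t-s)}\,dz_s ,\qquad t\ge0,$$ be the (mild) solution of the consensus SDE $dx_t=-Lx_t\,dt+dz_t$, and let $y_t=M_nx_t$ be the centred output, where $M_n=I_n-\frac1n\mathbf 1\mathbf 1^T$ and $y_0=M_nx_0$. Integrals against $Z_j$ are stable integrals, i.e. limits in probability of the integrals of dominated, almost everywhere convergent simple functions. Put $$\Phi(t)=\mathrm{diag}(0,e^{-\lambda_2t},\dots,e^{-\lambda_nt}),\qquad f_{lj}(t)=\sum_{k=2}^nq_{lk}q_{jk}e^{-\lambda_kt},\qquad q^{\langle\alpha\rangle}=\mathrm{sgn}(q)|q|^\alpha .$$ Then all stable integrals above and below exist, and the following hold. 1. For every $t\ge0$, almost surely, $$y_t=Q\Phi(t)Q^Ty_0+\int_0^tQ\Phi(t-s)Q^T\,dz_s .$$ 2. For every fixed $t\ge0$, $y_t$ is an $\alpha$-stable random vector (for independent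 copies $Y,Y'$ of $y_t$ and $a,b>0$, the vector $aY+bY'$ has the law of $(a^\alpha+b^\alpha)^{1/\alpha}y_t+d$ for some $d\in\mathbb R^n$). Each component satisfies $y^{(l)}_t\sim S_\alpha(\sigma_l(t),\beta_l(t),\mu_l(t)+(Q\Phi(t)Q^Ty_0)^{(l)})$, where $\sigma_l(t),\beta_l(t),\mu_l(t)$ are given by the formulas in 3 with $\int_0^\infty$ replaced by $\int_0^t$. 3. As $t\to\infty$, $y_t$ converges in distribution to a random vector $\bar y$ in $\mathbb R^n$ with $\bar y^{(l)}\sim S_\alpha(\sigma_l,\beta_l,\mu_l)$ for every $l$, where $$\sigma_l^\alpha=\sum_{j=1}^n\sigma_{lj}^\alpha,\qquad \sigma_{lj}^\alpha=\kappa\int_0^\infty|f_{lj}(s)|^\alpha\,ds,\qquad \beta_l=\frac{\kappa\sum_{j=1}^n\beta_j\int_0^\infty f_{lj}(s)^{\langle\alpha\rangle}\,ds}{\sigma_l^\alpha},$$ $$\mu_l=\begin{cases}0,&\alpha\ne1,\\-\frac2\pi\,\kappa\sum_{j=1}^n\beta_j\int_0^\infty f_{lj}(s)\ln|f_{lj}(s)|\,ds,&\alpha=1,\end{cases}$$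 all these integrals being absolutely convergent (and $\beta_l:=0$ if $\sigma_l=0$). In particular, for the normalization $\kappa=\frac1\alpha$ of the noise, $\sigma_{lj}^\alpha=\frac1\alpha\int_0^\infty|f_{lj}(s)|^\alpha\,ds$. -/

import Mathlib

open MeasureTheory ProbabilityTheory Filter Topology Matrix
open scoped NNReal ENNReal

noncomputable section

/-! ### Stable laws -/

/-- The function `ω(θ, α, β)` in the characteristic function of a stable law. -/
def stableOmega (θ α β : ℝ) : ℝ :=
  if α = 1 then -β * (2 / Real.pi) * Real.log |θ|
  else β * |θ| ^ (α - 1) * Real.tan (Real.pi * α / 2)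

/-- `ν` is the stable law `S_α(σ, β, μ)`. -/
structure IsStableLaw (α σ β μ : ℝ) (ν : Measure ℝ) : Prop where
  isProb : IsProbabilityMeasure ν
  index_pos : 0 < α
  index_le : α ≤ 2
  scale_nonneg : 0 ≤ σ
  skew_ge : -1 ≤ β
  skew_le : β ≤ 1
  charFun_eq : ∀ θ : ℝ, charFun ν θ =
    Complex.exp (((σ ^ α : ℝ) : ℂ) *
        (-((|θ| ^ α : ℝ) : ℂ) + Complex.I * (θ : ℂ) * ((stableOmega θ α β : ℝ) : ℂ))
      + Complex.I * (μ : ℂ) * (θ : ℂ))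

/-- The law `ν` on `ℝⁿ` is that of an `α`-stable random vector: if `X₁`, `X₂` are independent with
law `ν`, then for all `a, b > 0` the vector `a X₁ + b X₂` is distributed as
`(a^α + b^α)^(1/α) X + d` for some `d ∈ ℝⁿ`, where `X` has law `ν`. -/
structure IsStableVectorLaw (α : ℝ) {n : ℕ} (ν : Measure (Fin n → ℝ)) : Prop where
  isProb : IsProbabilityMeasure ν
  stable : ∀ a b : ℝ, 0 < a → 0 < b → ∃ d : Fin n → ℝ,
    (ν.prod ν).map (fun p => a • p.1 + b • p.2) =
      ν.map (fun v => (a ^ α + b ^ α) ^ (1 / α) • v + d)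

/-! ### Stable random measures and stable integrals -/

section RandomMeasure

variable {Ω : Type*} [MeasurableSpace Ω] {B : Type*} [MeasurableSpace B]

/-- The class of measurable sets of finite `m`-measure. -/
def finiteSets (m : Measure B) : Set (Set B) := {A | MeasurableSet A ∧ m A < ∞}

/-- `M` is an `α`-stable random measure on `B` with control measure `m` and skewness intensity
`β : B → [-1, 1]`. Only the values of `M` on sets of finite `m`-measure matter. The series in the
`σ`-additivity is understood as an almost sure limit of partial sums. -/
structure IsStableRandomMeasure (α : ℝ) (m : Measure B) (β : B → ℝ) (M : Set B → Ω → ℝ)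
    (P : Measure Ω) : Prop where
  measurable_skew : Measurable β
  skew_mem : ∀ x, β x ∈ Set.Icc (-1 : ℝ) 1
  measurable : ∀ A ∈ finiteSets m, Measurable (M A)
  indep : ∀ (k : ℕ) (A : Fin k → Set B), (∀ i, A i ∈ finiteSets m) →
    Pairwise (fun i j => Disjoint (A i) (A j)) → iIndepFun (fun i => M (A i)) P
  sigma_additive : ∀ A : ℕ → Set B, (∀ i, A i ∈ finiteSets m) →
    Pairwise (fun i j => Disjoint (A i) (A j)) → (⋃ i, A i) ∈ finiteSets m →
    ∀ᵐ ω ∂P, Tendsto (fun N => ∑ i ∈ Finset.range N, M (A i) ω) atTop (𝓝 (M (⋃ i, A i) ω))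
  law : ∀ A ∈ finiteSets m,
    IsStableLaw α ((m A).toReal ^ (1 / α)) ((∫ y in A, β y ∂m) / (m A).toReal) 0 (P.map (M A))

/-- The admissible integrands: `∫ |f|^α dm < ∞` and, when `α = 1`, also
`∫ |β f log |f|| dm < ∞` (needed for the shift of the integral to make sense). -/
structure StableIntegrable (α : ℝ) (m : Measure B) (β : B → ℝ) (f : B → ℝ) : Prop where
  measurable : Measurable f
  integrable_rpow : Integrable (fun x => |f x| ^ α) m
  integrable_log : α = 1 → Integrable (fun x => β x * (f x * Real.log |f x|)) m

/-- The integral of a simple function, `∑ c M({f = c})` over the nonzero values `c` of `f`. -/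
def simpleStableIntegral (M : Set B → Ω → ℝ) (f : SimpleFunc B ℝ) (ω : Ω) : ℝ :=
  ∑ c ∈ f.range.filter (fun c => c ≠ 0), c * M (f ⁻¹' {c}) ω

/-- `X` is (a version of) the stable integral `∫ f dM`: it is the limit in probability of the
integrals of simple functions that converge to `f` almost everywhere and are dominated by an
admissible function. -/
def HasStableIntegral (α : ℝ) (m : Measure B) (β : B → ℝ) (M : Set B → Ω → ℝ) (P : Measure Ω)
    (f : B → ℝ) (X : Ω → ℝ) : Prop :=
  AEMeasurable X P ∧
  ∃ (g : B → ℝ) (F : ℕ → SimpleFunc B ℝ),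
    StableIntegrable α m β g ∧
    (∀ k, (F k).FinMeasSupp m) ∧
    (∀ k x, |F k x| ≤ g x) ∧
    (∀ᵐ x ∂m, Tendsto (fun k => F k x) atTop (𝓝 (f x))) ∧
    TendstoInMeasure P (fun k => simpleStableIntegral M (F k)) atTop X

open Classical in
/-- The stable integral `∫ f dM`, determined up to almost sure equality; `0` if it does not
exist. -/
def stableIntegral (α : ℝ) (m : Measure B) (β : B → ℝ) (M : Set B → Ω → ℝ) (P : Measure Ω)
    (f : B → ℝ) : Ω → ℝ :=
  if h : ∃ X : Ω → ℝ, HasStableIntegral α m β M P f X then h.choose else 0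

end RandomMeasure

/-! ### Noise vectors on `[0, ∞)` and their convolution integrals -/

/-- The measure `κ · Lebesgue` on `[0, ∞)`. -/
def controlMeasure (κ : ℝ) : Measure ℝ≥0 :=
  ENNReal.ofReal κ • Measure.comap (fun s : ℝ≥0 => (s : ℝ)) volume

section Noise

variable {Ω : Type*} [MeasurableSpace Ω] {n : ℕ}

/-- `M₁, …, Mₙ` are independent `α`-stable random measures on `[0, ∞)` with control measure
`κ · Lebesgue` and constant skewness intensities `β₁, …, βₙ`. -/
structure IsStableNoise (α κ : ℝ) (β : Fin n → ℝ) (M : Fin n → Set ℝ≥0 → Ω → ℝ)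
    (P : Measure Ω) : Prop where
  isStableRandomMeasure : ∀ i,
    IsStableRandomMeasure α (controlMeasure κ) (fun _ => β i) (M i) P
  indep : iIndepFun
    (fun (i : Fin n) (ω : Ω) (A : finiteSets (controlMeasure κ)) => M i A ω) P

/-- The integrand `s ↦ h(t - s)` on `[0, t]`, extended by `0` to `(t, ∞)`. -/
def convKernel (h : ℝ → ℝ) (t s : ℝ≥0) : ℝ := if s ≤ t then h ((t : ℝ) - (s : ℝ)) else 0

/-- The random vector `∫₀ᵗ K(t - s) dz_s`, where `dz = (M₁, …, Mₙ)`. -/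
def noiseConv (α κ : ℝ) (β : Fin n → ℝ) (M : Fin n → Set ℝ≥0 → Ω → ℝ) (P : Measure Ω)
    (K : ℝ → Matrix (Fin n) (Fin n) ℝ) (t : ℝ≥0) (ω : Ω) : Fin n → ℝ := fun i =>
  ∑ j, stableIntegral α (controlMeasure κ) (fun _ => β j) (M j) P
    (convKernel (fun u => K u i j) t) ω

/-- All the stable integrals that occur in `∫₀ᵗ K(t - s) dz_s` exist. -/
def NoiseConvExists (α κ : ℝ) (β : Fin n → ℝ) (M : Fin n → Set ℝ≥0 → Ω → ℝ) (P : Measure Ω)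
    (K : ℝ → Matrix (Fin n) (Fin n) ℝ) (t : ℝ≥0) : Prop :=
  ∀ i j, StableIntegrable α (controlMeasure κ) (fun _ => β j) (convKernel (fun u => K u i j) t) ∧
    ∃ X, HasStableIntegral α (controlMeasure κ) (fun _ => β j) (M j) P
      (convKernel (fun u => K u i j) t) X

end Noise

/-! ### The consensus network -/

/-- `a` is a system of symmetric coupling weights for the simple graph `G`: positive on the links
of `G` and zero elsewhere. -/
structure IsCoupling {n : ℕ} (G : SimpleGraph (Fin n)) (a : Fin n → Fin n → ℝ) : Prop where
  symm : ∀ i j, a i j = a j i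
  pos : ∀ i j, G.Adj i j → 0 < a i j
  zero : ∀ i j, ¬ G.Adj i j → a i j = 0

/-- The weighted graph Laplacian. -/
def laplacian {n : ℕ} (a : Fin n → Fin n → ℝ) : Matrix (Fin n) (Fin n) ℝ :=
  Matrix.of fun i j => if i = j then ∑ k, a i k else -a i j

/-- The centering matrix `I - (1/n) 𝟏𝟏ᵀ`. -/
def centering (n : ℕ) : Matrix (Fin n) (Fin n) ℝ :=
  1 - (1 / (n : ℝ)) • Matrix.of fun _ _ => (1 : ℝ)

/-- `Φ(t) = diag(0, exp(-λ₂ t), …, exp(-λₙ t))`; the eigenvalues are indexed from `0`. -/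
def Phi {n : ℕ} (lam : Fin n → ℝ) (t : ℝ) : Matrix (Fin n) (Fin n) ℝ :=
  Matrix.diagonal fun k => if (k : ℕ) = 0 then 0 else Real.exp (-lam k * t)

/-- `f_{ij}(t) = ∑_{k ≥ 2} q_{ik} q_{jk} exp(-λ_k t)`; the eigenvalues are indexed from `0`. -/
def spectralFun {n : ℕ} (Q : Matrix (Fin n) (Fin n) ℝ) (lam : Fin n → ℝ) (i j : Fin n) (t : ℝ) :
    ℝ :=
  ∑ k with (k : Fin n).val ≠ 0, Q i k * Q j k * Real.exp (-lam k * t)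

/-- The signed power `q^{<α>}`. -/
def signedPow (q α : ℝ) : ℝ := Real.sign q * |q| ^ α

/-! Parameters of `∑ⱼ ∫ fⱼ dMⱼ` over the time set `T`, for control measure `κ · Lebesgue`. -/

/-- `σ^α = ∑ⱼ κ ∫_T |fⱼ|^α`. -/
def scalePow {n : ℕ} (α κ : ℝ) (f : Fin n → ℝ → ℝ) (T : Set ℝ) : ℝ :=
  ∑ j, κ * ∫ s in T, |f j s| ^ α

/-- The skewness `∑ⱼ βⱼ κ ∫_T fⱼ^{<α>} / σ^α` (equal to `0` if `σ = 0`). -/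
def skewParam {n : ℕ} (α κ : ℝ) (β : Fin n → ℝ) (f : Fin n → ℝ → ℝ) (T : Set ℝ) : ℝ :=
  (∑ j, β j * (κ * ∫ s in T, signedPow (f j s) α)) / scalePow α κ f T

/-- The shift: `0` if `α ≠ 1`, and `-(2/π) ∑ⱼ βⱼ κ ∫_T fⱼ log |fⱼ|` if `α = 1`. -/
def shiftParam {n : ℕ} (α κ : ℝ) (β : Fin n → ℝ) (f : Fin n → ℝ → ℝ) (T : Set ℝ) : ℝ :=
  if α = 1 then -(2 / Real.pi) * ∑ j, β j * (κ * ∫ s in T, f j s * Real.log |f j s|) else 0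

end

/-! ### Convergence in probability and its completeness. -/

section Convergence

variable {Ω : Type*} [MeasurableSpace Ω] {P : Measure Ω}

/-! Everything is carried by one formula. With ψ = `levyExponent α β`, the integral of a simple
function F against a stable random measure has characteristic function exp ∫ ψ(θF) dm
(`charFun_simpleStableIntegral`): the level sets are disjoint, so the values of M on them are
independent. The growth of ψ is controlled by `admissibleBound`, so the formula passes to dominated
limits (`tendsto_integral_levyExponent`). Applied to differences of approximants, it makes them
Cauchy in probability, which yields existence, uniqueness and linearity of the integral.

For vectors, a projection w · ∑ⱼ ∫ f(·, j) dMⱼ equals ∑ⱼ ∫ (∑ᵢ wᵢ fᵢⱼ) dMⱼ, a sum of integrals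
against independent noises. Its characteristic function at 1, for all w, is therefore explicit and
determines the joint law (Cramér–Wold, `ext_of_charFun_dotProduct`). Since ψ(au) = a^α ψ(u) plus an
imaginary linear drift (`levyExponent_mul`), such a law is stable. Taking w = θ e_l and separating θ
from the kernel inside ψ gives the scale, skewness and shift of each component
(`sum_integral_levyExponent`).

The network enters through its spectrum. The Dirichlet form shows that an eigenvector with
eigenvalue at most 0 is constant, so the first column of Q spans the constants and all later
eigenvalues are positive. Centering thus deletes exactly the nondecaying mode, M e^{-Lu} = Q Φ(u)
Qᵀ, and linearity of the integral gives the representation of y. The entries of Q Φ(u) Qᵀ decay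
exponentially, hence are admissible on all of (0, ∞).

For the limit, s ↦ t - s turns the law of the noise part of y_t into that of the fixed kernel f
integrated over (0, t]. Its exponent converges to the one over (0, ∞), the deterministic part
decays, and Lévy's continuity theorem concludes. The limit law is exhibited as that of ∑ⱼ ∫₀^∞ f(·,
j) dMⱼ for the same noise. -/

theorem tendstoInMeasure_zero_of_tendsto_charFun [IsProbabilityMeasure P]
    {X : ℕ → Ω → ℝ} (hX : ∀ k, AEMeasurable (X k) P)
    (h : ∀ θ, Tendsto (fun k => charFun (P.map (X k)) θ) atTop (𝓝 1)) :
    TendstoInMeasure P X atTop 0 := by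
  -- The laws converge weakly to the Dirac mass at 0. Because the limit is constant, the portmanteau
  -- inequality on the closed set {ε ≤ ‖x‖} turns this into convergence in probability.
  let μ : ℕ → ProbabilityMeasure ℝ := fun k => ⟨P.map (X k), Measure.isProbabilityMeasure_map (hX k)⟩
  let μ₀ : ProbabilityMeasure ℝ := ⟨Measure.dirac 0, inferInstance⟩
  have hw : Tendsto μ atTop (𝓝 μ₀) := by
    rw [ProbabilityMeasure.tendsto_iff_tendsto_charFun]
    intro θ
    have : charFun (μ₀ : Measure ℝ) θ = 1 := by simp [μ₀, charFun_dirac]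
    rw [this]
    exact h θ
  rw [tendstoInMeasure_iff_norm]
  intro ε hε
  have hcl : IsClosed {x : ℝ | ε ≤ ‖x‖} := isClosed_le continuous_const continuous_norm
  have hlim := FiniteMeasure.limsup_measure_closed_le_of_tendsto
    ((ProbabilityMeasure.tendsto_nhds_iff_toFiniteMeasure_tendsto_nhds atTop).1 hw) hcl
  have h0 : (μ₀ : Measure ℝ) {x : ℝ | ε ≤ ‖x‖} = 0 := by
    simp only [μ₀, ProbabilityMeasure.coe_mk]
    rw [Measure.dirac_apply' _ hcl.measurableSet]
    simp [hε]
  have hev : ∀ k, P {x | ε ≤ ‖X k x - (0 : Ω → ℝ) x‖} = (μ k : Measure ℝ) {x : ℝ | ε ≤ ‖x‖} := by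
    intro k
    simp only [μ, ProbabilityMeasure.coe_mk]
    rw [Measure.map_apply_of_aemeasurable (hX k) hcl.measurableSet]
    simp
  simp_rw [hev]
  have hle : limsup (fun k => (μ k : Measure ℝ) {x : ℝ | ε ≤ ‖x‖}) atTop ≤ 0 := h0 ▸ hlim
  exact tendsto_of_le_liminf_of_limsup_le zero_le hle

theorem MeasureTheory.TendstoInMeasure.tendsto_charFun [IsProbabilityMeasure P]
    {X : ℕ → Ω → ℝ} {Z : Ω → ℝ}
    (hX : ∀ k, AEMeasurable (X k) P) (h : TendstoInMeasure P X atTop Z) (θ : ℝ) :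
    Tendsto (fun k => charFun (P.map (X k)) θ) atTop (𝓝 (charFun (P.map Z) θ)) :=
  ProbabilityMeasure.tendsto_iff_tendsto_charFun.1 (h.tendstoInDistribution hX).tendsto θ

theorem MeasureTheory.TendstoInMeasure.add {E : Type*} [SeminormedAddCommGroup E] {X Y : ℕ → Ω → E} {Z W : Ω → E}
    (hX : TendstoInMeasure P X atTop Z) (hY : TendstoInMeasure P Y atTop W) :
    TendstoInMeasure P (fun k => X k + Y k) atTop (Z + W) := by
  rw [tendstoInMeasure_iff_norm] at *
  intro ε hε
  have h := (hX (ε / 2) (by positivity)).add (hY (ε / 2) (by positivity))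
  rw [add_zero] at h
  refine tendsto_of_tendsto_of_tendsto_of_le_of_le tendsto_const_nhds h (fun _ => zero_le)
    fun k => (measure_mono fun ω hω => ?_).trans (measure_union_le _ _)
  simp only [Set.mem_ofPred_eq, Set.mem_union, Pi.add_apply] at hω ⊢
  by_contra! hc
  have : X k ω + Y k ω - (Z ω + W ω) = (X k ω - Z ω) + (Y k ω - W ω) := by abel
  rw [this] at hω
  linarith [norm_add_le (X k ω - Z ω) (Y k ω - W ω)]

theorem MeasureTheory.TendstoInMeasure.const_mul {X : ℕ → Ω → ℝ} {Z : Ω → ℝ}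
    (hX : TendstoInMeasure P X atTop Z) (c : ℝ) :
    TendstoInMeasure P (fun k ω => c * X k ω) atTop (fun ω => c * Z ω) := by
  rw [tendstoInMeasure_iff_norm] at *
  intro ε hε
  rcases eq_or_ne c 0 with rfl | hc
  · simp [not_le.2 hε]
  · refine (hX (ε / |c|) (by positivity)).congr fun k => ?_
    congr 1 with ω
    simp only [Set.mem_ofPred_eq, ← mul_sub, norm_mul, Real.norm_eq_abs]
    rw [div_le_iff₀' (by positivity)]

theorem MeasureTheory.TendstoInMeasure.finsetSum {ι : Type*} (s : Finset ι) {X : ι → ℕ → Ω → ℝ} {Z : ι → Ω → ℝ}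
    (hX : ∀ i ∈ s, TendstoInMeasure P (X i) atTop (Z i)) :
    TendstoInMeasure P (fun k => ∑ i ∈ s, X i k) atTop (∑ i ∈ s, Z i) := by
  classical
  induction s using Finset.induction with
  | empty =>
    rw [tendstoInMeasure_iff_norm]
    intro ε hε
    simp [not_le.2 hε]
  | insert i s hi ih =>
    simp_rw [Finset.sum_insert hi]
    exact (hX i (by simp)).add (ih fun j hj => hX j (by simp [hj]))

/-- Completeness of convergence in probability. The Cauchy property is stated for pairs of
subsequences. -/
theorem exists_tendstoInMeasure_of_cauchy [IsProbabilityMeasure P]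
    {X : ℕ → Ω → ℝ} (hX : ∀ k, AEMeasurable (X k) P)
    (h : ∀ a b : ℕ → ℕ, Tendsto a atTop atTop → Tendsto b atTop atTop →
      TendstoInMeasure P (fun k => X (a k) - X (b k)) atTop 0) :
    ∃ Z : Ω → ℝ, AEMeasurable Z P ∧ TendstoInMeasure P X atTop Z := by
  -- If this failed, bad pairs of indices beyond every N would form two sequences a, b contradicting
  -- `h`.
  have hunif : ∀ ε : ℝ, 0 < ε → ∀ δ : ℝ≥0∞, 0 < δ → ∃ N, ∀ k ≥ N, ∀ l ≥ N,
      P {ω | ε ≤ ‖X k ω - X l ω‖} < δ := by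
    intro ε hε δ hδ
    by_contra! hc
    choose a ha b hb hab using hc
    have := (tendstoInMeasure_iff_norm.1 (h a b (tendsto_atTop_mono ha tendsto_id)
      (tendsto_atTop_mono hb tendsto_id))) ε hε
    obtain ⟨k, hk⟩ := (this.eventually (gt_mem_nhds hδ)).exists
    simp only [Pi.sub_apply, Pi.zero_apply, sub_zero] at hk
    exact absurd (hab k) (not_le.2 hk)
  have hsub : ∀ k : ℕ, ∃ N, ∀ i ≥ N, ∀ j ≥ N,
      P {ω | (1 / 2 : ℝ) ^ k ≤ ‖X i ω - X j ω‖} < (2 : ℝ≥0∞)⁻¹ ^ k := fun k =>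
    hunif _ (by positivity) _ (by simp [pos_iff_ne_zero])
  choose N hN using hsub
  let u : ℕ → ℕ := fun k => ∑ i ∈ Finset.range (k + 1), (N i + 1)
  have huN : ∀ k, N k ≤ u k := fun k => by
    simp only [u, Finset.sum_range_succ]; omega
  have hu_succ : ∀ k, u k < u (k + 1) := fun k => by
    simp only [u]; rw [Finset.sum_range_succ _ (k + 1)]; omega
  have hu : StrictMono u := strictMono_nat_of_lt_succ hu_succ
  -- Borel–Cantelli along the fast subsequence u: almost surely its increments are eventually below
  -- 2^{-k}.
  have hbc : ∀ᵐ ω ∂P, ∀ᶠ k in atTop,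
      ω ∉ {ω | (1 / 2 : ℝ) ^ k ≤ ‖X (u k) ω - X (u (k + 1)) ω‖} := by
    refine ae_eventually_notMem (ne_top_of_le_ne_top ?_ (ENNReal.tsum_le_tsum fun k =>
      (hN k (u k) (huN k) (u (k + 1)) ((huN k).trans (hu_succ k).le)).le))
    simpa only [ENNReal.tsum_geometric, ENNReal.one_sub_inv_two, inv_inv] using ENNReal.ofNat_ne_top
  have hconv : ∀ᵐ ω ∂P, ∃ z, Tendsto (fun k => X (u k) ω) atTop (𝓝 z) := by
    filter_upwards [hbc] with ω hω
    obtain ⟨K, hK⟩ := eventually_atTop.1 hω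
    have hc : CauchySeq fun k => X (u (k + K)) ω := by
      refine cauchySeq_of_le_geometric (1 / 2) 1 (by norm_num) fun k => ?_
      have := hK (k + K) (by omega)
      simp only [not_le] at this
      rw [dist_eq_norm, one_mul, show k + 1 + K = k + K + 1 by ring]
      exact this.le.trans (pow_le_pow_of_le_one (by norm_num) (by norm_num) (by omega))
    obtain ⟨z, hz⟩ := cauchySeq_tendsto_of_complete hc
    exact ⟨z, (tendsto_add_atTop_iff_nat (f := fun k => X (u k) ω) K).1 hz⟩
  choose! Z hZ using (fun ω (hω : ∃ z, Tendsto (fun k => X (u k) ω) atTop (𝓝 z)) => hω)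
  have hlim : ∀ᵐ ω ∂P, Tendsto (fun k => X (u k) ω) atTop (𝓝 (Z ω)) := hconv.mono hZ
  refine ⟨Z, aemeasurable_of_tendsto_metrizable_ae atTop (fun k => hX (u k)) hlim, ?_⟩
  have h1 : TendstoInMeasure P (fun k => X (u k)) atTop Z :=
    tendstoInMeasure_of_tendsto_ae (fun k => (hX _).aestronglyMeasurable) hlim
  have h2 := (h id u tendsto_id hu.tendsto_atTop).add h1
  refine (h2.congr_left fun k => ?_).congr_right ?_
  · exact ae_of_all _ fun ω => by simp
  · exact ae_of_all _ fun ω => by simp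

end Convergence

noncomputable section

/-! ### The characteristic exponent and its growth. -/

section Exponent

/-- The characteristic exponent of `S_α(1, β, 0)`. -/
def levyExponent (α β u : ℝ) : ℂ :=
  -((|u| ^ α : ℝ) : ℂ) + Complex.I * (u : ℂ) * ((stableOmega u α β : ℝ) : ℂ)

/-- The function whose integrability expresses the admissibility of an integrand. -/
def admissibleBound (α β u : ℝ) : ℝ :=
  |u| ^ α + if α = 1 then |β * (u * Real.log |u|)| else 0

variable {α β : ℝ}

theorem signedPow_eq_mul_rpow (u : ℝ) : signedPow u α = u * |u| ^ (α - 1) := by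
  rcases eq_or_ne u 0 with rfl | hu
  · simp [signedPow]
  · rw [Real.rpow_sub_one (abs_ne_zero.2 hu), signedPow]
    rcases lt_or_gt_of_ne hu with h | h
    · rw [Real.sign_of_neg h, abs_of_neg h]; field_simp
    · rw [Real.sign_of_pos h, abs_of_pos h]; field_simp

theorem abs_signedPow (hα : 0 < α) (u : ℝ) : |signedPow u α| = |u| ^ α := by
  rcases eq_or_ne u 0 with rfl | hu
  · simp [signedPow, Real.zero_rpow hα.ne']
  · rw [signedPow, abs_mul, abs_of_nonneg (Real.rpow_nonneg (abs_nonneg u) α)]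
    rcases lt_or_gt_of_ne hu with h | h
    · simp [Real.sign_of_neg h]
    · simp [Real.sign_of_pos h]

theorem signedPow_mul (x y : ℝ) : signedPow (x * y) α = signedPow x α * signedPow y α := by
  simp only [signedPow, abs_mul, Real.mul_rpow (abs_nonneg x) (abs_nonneg y)]
  have : Real.sign (x * y) = Real.sign x * Real.sign y := by
    rcases lt_trichotomy x 0 with hx | rfl | hx <;> rcases lt_trichotomy y 0 with hy | rfl | hy <;>
      simp [Real.sign_of_neg, Real.sign_of_pos, *, mul_pos_of_neg_of_neg, mul_neg_of_neg_of_pos,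
        mul_neg_of_pos_of_neg]
  rw [this]; ring

theorem continuous_signedPow (hα : 0 < α) : Continuous fun u : ℝ => signedPow u α := by
  rw [continuous_iff_continuousAt]
  intro u
  -- The factorisation u |u|^(α-1) serves away from 0; for α < 1 its second factor is unbounded near
  -- 0, where the modulus |u|^α is squeezed instead.
  rcases eq_or_ne u 0 with rfl | hu
  · have h : Tendsto (fun u : ℝ => |u| ^ α) (𝓝 0) (𝓝 0) := by
      have : Continuous fun u : ℝ => |u| ^ α := continuous_abs.rpow_const fun _ => Or.inr hα.le
      simpa [Real.zero_rpow hα.ne'] using this.tendsto 0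
    rw [ContinuousAt]
    have h0 : signedPow 0 α = 0 := by simp [signedPow]
    rw [h0]
    exact squeeze_zero_norm (fun u => (abs_signedPow hα u).le) h
  · simp_rw [signedPow_eq_mul_rpow]
    exact continuousAt_id.mul (continuous_abs.continuousAt.rpow_const (Or.inl (abs_ne_zero.2 hu)))

theorem levyExponent_of_ne_one (h1 : α ≠ 1) (u : ℝ) :
    levyExponent α β u = -((|u| ^ α : ℝ) : ℂ)
      + Complex.I * ((β * Real.tan (Real.pi * α / 2) * signedPow u α : ℝ) : ℂ) := by
  rw [levyExponent, stableOmega, if_neg h1, signedPow_eq_mul_rpow]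
  push_cast; ring

theorem levyExponent_one (u : ℝ) :
    levyExponent 1 β u = -((|u| : ℝ) : ℂ)
      + Complex.I * ((-(2 / Real.pi) * (β * (u * Real.log |u|)) : ℝ) : ℂ) := by
  rw [levyExponent, stableOmega, if_pos rfl, Real.rpow_one]
  push_cast; ring

@[simp] theorem levyExponent_zero (hα : 0 < α) : levyExponent α β 0 = 0 := by
  simp [levyExponent, Real.zero_rpow hα.ne']

theorem continuous_levyExponent (hα : 0 < α) : Continuous (levyExponent α β) := by
  by_cases h1 : α = 1
  · subst h1
    simp_rw [funext levyExponent_one, Real.log_abs]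
    have := Real.continuous_mul_log
    fun_prop
  · simp_rw [funext (levyExponent_of_ne_one h1)]
    have h := continuous_signedPow hα
    have h' : Continuous fun u : ℝ => |u| ^ α := continuous_abs.rpow_const fun _ => Or.inr hα.le
    fun_prop

theorem admissibleBound_nonneg (u : ℝ) : 0 ≤ admissibleBound α β u := by
  unfold admissibleBound; split_ifs <;> positivity

theorem continuous_admissibleBound (hα : 0 < α) : Continuous (admissibleBound α β) := by
  have h' : Continuous fun u : ℝ => |u| ^ α := continuous_abs.rpow_const fun _ => Or.inr hα.le
  unfold admissibleBound
  simp_rw [Real.log_abs]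
  have := Real.continuous_mul_log
  split_ifs <;> fun_prop

/-- One constant covers both cases: the tangent is needed for α ≠ 1, the 2/π for α = 1. -/
theorem norm_levyExponent_le (hα : 0 < α) (u : ℝ) :
    ‖levyExponent α β u‖
      ≤ (1 + |β * Real.tan (Real.pi * α / 2)| + 2 / Real.pi) * admissibleBound α β u := by
  have hp := Real.pi_pos
  have hb : 0 ≤ |u| ^ α := by positivity
  by_cases h1 : α = 1
  · subst h1
    rw [levyExponent_one]
    refine (norm_add_le _ _).trans ?_
    have h4 : 0 < 2 / Real.pi := by positivity
    rw [norm_neg, norm_mul, Complex.norm_I, one_mul, Complex.norm_real, Complex.norm_real,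
      Real.norm_eq_abs, Real.norm_eq_abs, abs_abs, abs_mul, abs_neg, abs_of_pos h4,
      admissibleBound, if_pos rfl, Real.rpow_one]
    have h2 := abs_nonneg (β * (u * Real.log |u|))
    have h3 := abs_nonneg (β * Real.tan (Real.pi * 1 / 2))
    nlinarith [abs_nonneg u, mul_nonneg h3 h2, mul_nonneg h3 (abs_nonneg u),
      mul_nonneg h4.le (abs_nonneg u)]
  · rw [levyExponent_of_ne_one h1]
    refine (norm_add_le _ _).trans ?_
    rw [norm_neg, norm_mul, Complex.norm_I, one_mul, Complex.norm_real, Complex.norm_real,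
      Real.norm_eq_abs, Real.norm_eq_abs, abs_mul, abs_signedPow hα, abs_of_nonneg hb,
      admissibleBound, if_neg h1]
    have h4 : 0 ≤ 2 / Real.pi := by positivity
    nlinarith [mul_nonneg h4 hb]

/-- The function |u log|u|| is not monotone in |u|, having a bump on (0, 1). For |u| ≤ 1 the
inequality log x ≤ x - 1 at x = |g|/|u| shows that an extra |g| pays for the failure. -/
theorem abs_mul_log_le {u g : ℝ} (h : |u| ≤ |g|) :
    |u * Real.log (|u|)| ≤ |g * Real.log (|g|)| + |g| := by
  rcases eq_or_ne u 0 with rfl | hu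
  · simp; positivity
  have hu' : 0 < |u| := abs_pos.2 hu
  rw [abs_mul, abs_mul]
  rcases le_total 1 |u| with h1 | h1
  · rw [abs_of_nonneg (Real.log_nonneg h1), abs_of_nonneg (Real.log_nonneg (h1.trans h))]
    have := Real.log_le_log hu' h
    nlinarith [mul_le_mul h this (Real.log_nonneg h1) (abs_nonneg g), abs_nonneg g]
  · have hlu := Real.log_nonpos hu'.le h1
    rw [abs_of_nonpos hlu]
    -- `-log (u / g) ≤ g / u` and `-log u = -log (u / g) - log g`
    have hg : 0 < |g| := hu'.trans_le h
    have h2 : Real.log (|g| / |u|) ≤ |g| / |u| - 1 := Real.log_le_sub_one_of_pos (by positivity)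
    rw [Real.log_div hg.ne' hu'.ne'] at h2
    have h3 : |u| * (-Real.log |u|) ≤ |u| * (-Real.log |g|) + |g| := by
      have := mul_le_mul_of_nonneg_left h2 hu'.le
      have h5 : |u| * (|g| / |u|) = |g| := mul_div_cancel₀ _ hu'.ne'
      rw [mul_sub, mul_sub, h5] at this
      linarith
    have h4 : |u| * (-Real.log |g|) ≤ |g| * |Real.log (|g|)| := by
      rcases le_total 0 (-Real.log |g|) with h0 | h0
      · exact mul_le_mul h (neg_le_abs _) h0 hg.le
      · exact (mul_nonpos_of_nonneg_of_nonpos hu'.le h0).trans (by positivity)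
    linarith

/-- Turns pointwise domination of integrands into domination of exponents. When α = 1 the factor 1 +
|β| absorbs the extra |g| of `abs_mul_log_le`. -/
theorem admissibleBound_mono (hα : 0 < α) {u g : ℝ} (h : |u| ≤ |g|) :
    admissibleBound α β u ≤ (1 + |β|) * admissibleBound α β g := by
  have h1 := Real.rpow_le_rpow (abs_nonneg u) h hα.le
  have h2 : 0 ≤ |g| ^ α := by positivity
  unfold admissibleBound
  split_ifs with ha
  · subst ha
    have h3 := mul_le_mul_of_nonneg_left (abs_mul_log_le h) (abs_nonneg β)
    rw [Real.rpow_one] at *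
    rw [Real.rpow_one] at *
    rw [abs_mul, abs_mul β]
    have h4 : 0 ≤ |β| * |g * Real.log (|g|)| := by positivity
    nlinarith [mul_nonneg (abs_nonneg β) h4]
  · nlinarith [mul_nonneg (abs_nonneg β) h2]

/-- For α = 1, log|cu| = log|c| + log|u| leaves over a multiple of |u|, which is itself part of the
bound. -/
theorem admissibleBound_mul_le (c u : ℝ) :
    admissibleBound α β (c * u)
      ≤ (|c| ^ α + |c| + |β| * |c * Real.log (|c|)|) * admissibleBound α β u := by
  have hc : 0 ≤ |c| ^ α := by positivity
  have hu : 0 ≤ |u| ^ α := by positivity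
  unfold admissibleBound
  rw [abs_mul, Real.mul_rpow (abs_nonneg _) (abs_nonneg _)]
  split_ifs with ha
  · subst ha
    rw [Real.rpow_one, Real.rpow_one] at *
    have : |β * (c * u * Real.log (|c| * |u|))|
        ≤ |β| * |c * Real.log (|c|)| * |u| + |c| * |β * (u * Real.log |u|)| := by
      rcases eq_or_ne c 0 with rfl | hc0
      · simp
      rcases eq_or_ne u 0 with rfl | hu0
      · simp
      rw [Real.log_mul (abs_ne_zero.2 hc0) (abs_ne_zero.2 hu0),
        show β * (c * u * (Real.log |c| + Real.log |u|))
          = β * (c * Real.log |c|) * u + c * (β * (u * Real.log |u|)) by ring]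
      refine (abs_add_le _ _).trans (le_of_eq ?_)
      rw [abs_mul (β * (c * Real.log |c|)), abs_mul β, abs_mul c (β * _)]
    have h1 := abs_nonneg (β * (u * Real.log |u|))
    have h2 : 0 ≤ |β| * |c * Real.log (|c|)| := by positivity
    nlinarith [mul_nonneg h2 h1, mul_nonneg hc h1, mul_nonneg hc hu]
  · have h2 : 0 ≤ |β| * |c * Real.log (|c|)| := by positivity
    nlinarith [mul_nonneg h2 hu, mul_nonneg (abs_nonneg c) hu]

end Exponent

/-! ### Admissible integrands and dominated convergence of exponents. -/

section Admissible

variable {B : Type*} [MeasurableSpace B] {m : Measure B} {α β : ℝ}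

theorem stableIntegrable_iff_integrable_admissibleBound {f : B → ℝ} :
    StableIntegrable α m (fun _ => β) f ↔
      Measurable f ∧ Integrable (fun x => admissibleBound α β (f x)) m := by
  constructor
  · intro h
    refine ⟨h.measurable, h.integrable_rpow.add ?_⟩
    split_ifs with ha
    · exact (h.integrable_log ha).abs
    · exact integrable_zero _ _ _
  · rintro ⟨hm, hi⟩
    refine ⟨hm, hi.mono' ?_ (ae_of_all _ fun x => ?_), fun ha =>
      hi.mono' ?_ (ae_of_all _ fun x => ?_)⟩
    · exact (hm.abs.pow_const α).aestronglyMeasurable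
    · rw [Real.norm_of_nonneg (by positivity), admissibleBound]
      exact le_add_of_nonneg_right (by split_ifs <;> positivity)
    · exact ((hm.mul (Real.measurable_log.comp hm.abs)).const_mul β).aestronglyMeasurable
    · rw [Real.norm_eq_abs, admissibleBound, if_pos ha]
      exact le_add_of_nonneg_left (by positivity)

theorem StableIntegrable.mono (hα : 0 < α) {f g : B → ℝ} (hg : StableIntegrable α m (fun _ => β) g)
    (hf : Measurable f) (hfg : ∀ x, |f x| ≤ |g x|) : StableIntegrable α m (fun _ => β) f := by
  rw [stableIntegrable_iff_integrable_admissibleBound] at *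
  refine ⟨hf, (hg.2.const_mul (1 + |β|)).mono' ?_ (ae_of_all _ fun x => ?_)⟩
  · exact ((continuous_admissibleBound hα).measurable.comp hf).aestronglyMeasurable
  · rw [Real.norm_of_nonneg (admissibleBound_nonneg _)]
    exact admissibleBound_mono hα (hfg x)

theorem StableIntegrable.const_mul (hα : 0 < α) {f : B → ℝ}
    (hf : StableIntegrable α m (fun _ => β) f) (c : ℝ) :
    StableIntegrable α m (fun _ => β) (fun x => c * f x) := by
  rw [stableIntegrable_iff_integrable_admissibleBound] at *
  refine ⟨hf.1.const_mul c, (hf.2.const_mul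
    (|c| ^ α + |c| + |β| * |c * Real.log (|c|)|)).mono' ?_ (ae_of_all _ fun x => ?_)⟩
  · exact ((continuous_admissibleBound hα).measurable.comp (hf.1.const_mul c)).aestronglyMeasurable
  · rw [Real.norm_of_nonneg (admissibleBound_nonneg _)]
    exact admissibleBound_mul_le c (f x)

/-- The sum is at most 2 max(|f|, |g|), and the maximum equals one of the two at every point, so no
subadditivity of u log|u| is required. -/
theorem StableIntegrable.abs_add_abs (hα : 0 < α) {f g : B → ℝ}
    (hf : StableIntegrable α m (fun _ => β) f) (hg : StableIntegrable α m (fun _ => β) g) :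
    StableIntegrable α m (fun _ => β) (fun x => |f x| + |g x|) := by
  have hmax : StableIntegrable α m (fun _ => β) (fun x => max |f x| |g x|) := by
    rw [stableIntegrable_iff_integrable_admissibleBound] at *
    refine ⟨hf.1.abs.max hg.1.abs, ((hf.2.add hg.2).const_mul (1 + |β|)).mono' ?_
      (ae_of_all _ fun x => ?_)⟩
    · exact ((continuous_admissibleBound hα).measurable.comp
        (hf.1.abs.max hg.1.abs)).aestronglyMeasurable
    · rw [Real.norm_of_nonneg (admissibleBound_nonneg _), Pi.add_apply, mul_add]
      have h1 := admissibleBound_nonneg (α := α) (β := β) (f x)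
      have h2 := admissibleBound_nonneg (α := α) (β := β) (g x)
      rcases le_total |f x| |g x| with h | h
      · rw [max_eq_right h]
        refine (admissibleBound_mono hα (abs_abs _).le).trans (le_add_of_nonneg_left (by positivity))
      · rw [max_eq_left h]
        refine (admissibleBound_mono hα (abs_abs _).le).trans (le_add_of_nonneg_right (by positivity))
  refine (hmax.const_mul hα 2).mono hα (hf.measurable.abs.add hg.measurable.abs) fun x => ?_
  rw [abs_of_nonneg (add_nonneg (abs_nonneg _) (abs_nonneg _))]
  refine le_trans ?_ (le_abs_self _)
  linarith [le_max_left |f x| |g x|, le_max_right |f x| |g x|]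

theorem StableIntegrable.add (hα : 0 < α) {f g : B → ℝ}
    (hf : StableIntegrable α m (fun _ => β) f) (hg : StableIntegrable α m (fun _ => β) g) :
    StableIntegrable α m (fun _ => β) (fun x => f x + g x) :=
  (hf.abs_add_abs hα hg).mono hα (hf.measurable.add hg.measurable) fun _ =>
    (abs_add_le _ _).trans (le_abs_self _)

theorem StableIntegrable.integrable_levyExponent (hα : 0 < α) {f : B → ℝ}
    (hf : StableIntegrable α m (fun _ => β) f) : Integrable (fun x => levyExponent α β (f x)) m :=
  (((stableIntegrable_iff_integrable_admissibleBound).1 hf).2.const_mul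
    (1 + |β * Real.tan (Real.pi * α / 2)| + 2 / Real.pi)).mono'
    ((continuous_levyExponent hα).measurable.comp hf.measurable).aestronglyMeasurable
    (ae_of_all _ fun _ => norm_levyExponent_le hα _)

theorem tendsto_integral_levyExponent (hα : 0 < α) {g f : B → ℝ} {F : ℕ → B → ℝ}
    (hg : StableIntegrable α m (fun _ => β) g) (hF : ∀ k, Measurable (F k))
    (hFg : ∀ k x, |F k x| ≤ |g x|) (hlim : ∀ᵐ x ∂m, Tendsto (fun k => F k x) atTop (𝓝 (f x))) :
    Tendsto (fun k => ∫ x, levyExponent α β (F k x) ∂m) atTop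
      (𝓝 (∫ x, levyExponent α β (f x) ∂m)) := by
  refine tendsto_integral_of_dominated_convergence
    (fun x => (1 + |β * Real.tan (Real.pi * α / 2)| + 2 / Real.pi) *
      ((1 + |β|) * admissibleBound α β (g x))) (fun k => ?_) ?_ (fun k => ae_of_all _ fun _ => ?_) ?_
  · exact ((continuous_levyExponent hα).measurable.comp (hF k)).aestronglyMeasurable
  · exact (((stableIntegrable_iff_integrable_admissibleBound).1 hg).2.const_mul _).const_mul _
  · refine (norm_levyExponent_le hα _).trans (mul_le_mul_of_nonneg_left ?_ ?_)
    · exact admissibleBound_mono hα (hFg k _)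
    · have := Real.pi_pos; positivity
  · filter_upwards [hlim] with x hx
    exact ((continuous_levyExponent hα).tendsto _).comp hx

end Admissible

end

/-! ### Integrals of simple functions. -/

section RandomMeasure

variable {Ω : Type*} [MeasurableSpace Ω] {P : Measure Ω} {B : Type*} [MeasurableSpace B]
  {m : Measure B} {α β : ℝ} {M : Set B → Ω → ℝ}

namespace IsStableRandomMeasure

theorem charFun_map (hα : 0 < α) (hM : IsStableRandomMeasure α m (fun _ => β) M P) {A : Set B}
    (hA : A ∈ finiteSets m) (θ : ℝ) :
    charFun (P.map (M A)) θ = Complex.exp ((m A).toReal * levyExponent α β θ) := by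
  rw [(hM.law A hA).charFun_eq, ← Real.rpow_mul ENNReal.toReal_nonneg, one_div_mul_cancel hα.ne',
    Real.rpow_one]
  -- On null sets the averaged skewness is the junk value 0/0, but it is multiplied by m(A) = 0.
  rcases eq_or_ne (m A).toReal 0 with h | h
  · simp [h]
  · have : (∫ _ in A, β ∂m) / (m A).toReal = β := by
      rw [setIntegral_const, Measure.real, smul_eq_mul, mul_div_cancel_left₀ _ h]
    rw [this, levyExponent]
    simp

/-- Applied to the constant sequence ∅, σ-additivity says that k · M(∅) converges, so its constant
increment M(∅) is 0. -/
theorem apply_empty (hM : IsStableRandomMeasure α m (fun _ => β) M P) : ∀ᵐ ω ∂P, M ∅ ω = 0 := by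
  have h := hM.sigma_additive (fun _ => ∅) (fun _ => ⟨.empty, by simp⟩)
    (fun _ _ _ => Set.disjoint_empty _) (by simpa using ⟨.empty, by simp⟩)
  filter_upwards [h] with ω hω
  simp only [Finset.sum_const, Finset.card_range, nsmul_eq_mul, Set.iUnion_empty] at hω
  have h1 := (tendsto_add_atTop_iff_nat 1).2 hω
  have h2 := h1.sub hω
  simp only [Nat.cast_add, Nat.cast_one, sub_self] at h2
  have h3 : (fun k : ℕ => ((k : ℝ) + 1) * M ∅ ω - k * M ∅ ω) = fun _ => M ∅ ω := by
    ext k; ring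
  rw [h3] at h2
  exact tendsto_nhds_unique tendsto_const_nhds h2

theorem apply_union (hM : IsStableRandomMeasure α m (fun _ => β) M P) {A C : Set B}
    (hA : A ∈ finiteSets m) (hC : C ∈ finiteSets m) (hAC : Disjoint A C) :
    ∀ᵐ ω ∂P, M (A ∪ C) ω = M A ω + M C ω := by
  let S : ℕ → Set B := fun k => if k = 0 then A else if k = 1 then C else ∅
  have hS : ∀ k, S k ∈ finiteSets m := fun k => by
    simp only [S]; split_ifs
    exacts [hA, hC, ⟨.empty, by simp⟩]
  have hU : ⋃ k, S k = A ∪ C := by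
    ext x
    simp only [Set.mem_iUnion, Set.mem_union, S]
    constructor
    · rintro ⟨k, hk⟩
      split_ifs at hk
      exacts [Or.inl hk, Or.inr hk, absurd hk (Set.notMem_empty x)]
    · rintro (h | h)
      exacts [⟨0, by simpa⟩, ⟨1, by simpa⟩]
  have hd : Pairwise (fun i j => Disjoint (S i) (S j)) := by
    intro i j hij
    simp only [S]
    split_ifs <;> first | omega | simp | exact hAC | exact hAC.symm
  have h := hM.sigma_additive S hS hd
    (hU ▸ ⟨hA.1.union hC.1, (measure_union_le _ _).trans_lt (ENNReal.add_lt_top.2 ⟨hA.2, hC.2⟩)⟩)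
  rw [hU] at h
  filter_upwards [h, hM.apply_empty] with ω hω h0
  refine tendsto_nhds_unique hω (tendsto_atTop_of_eventually_const (i₀ := 2) fun k hk => ?_)
  obtain ⟨l, rfl⟩ := Nat.exists_eq_add_of_le hk
  rw [Finset.sum_range_add]
  have hne : ∀ x, 2 + x ≠ 1 := fun x => by omega
  simp [Finset.sum_range_succ, S, h0, hne]

theorem apply_biUnion (hM : IsStableRandomMeasure α m (fun _ => β) M P) {ι : Type*} (s : Finset ι)
    {A : ι → Set B} (hA : ∀ i ∈ s, A i ∈ finiteSets m) (hd : Pairwise fun i j => Disjoint (A i) (A j)) :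
    ∀ᵐ ω ∂P, M (⋃ i ∈ s, A i) ω = ∑ i ∈ s, M (A i) ω := by
  classical
  induction s using Finset.induction with
  | empty => simpa using hM.apply_empty
  | insert i s hi ih =>
    have hA' : ∀ j ∈ s, A j ∈ finiteSets m := fun j hj => hA j (by simp [hj])
    have hU : (⋃ j ∈ s, A j) ∈ finiteSets m :=
      ⟨s.measurableSet_biUnion fun j hj => (hA' j hj).1,
        measure_biUnion_lt_top s.finite_toSet fun j hj => (hA' j hj).2⟩
    have hdis : Disjoint (A i) (⋃ j ∈ s, A j) := by
      simp only [Set.disjoint_iUnion_right]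
      exact fun j hj => hd fun h => hi (h ▸ hj)
    filter_upwards [ih hA', hM.apply_union (hA i (by simp)) hU hdis] with ω h1 h2
    rw [Finset.set_biUnion_insert, h2, h1, Finset.sum_insert hi]

/-- The integral is defined by grouping equal values; additivity lets it be computed on any finer
partition. Level sets of H where g vanishes may have infinite measure, since their terms carry the
coefficient 0. -/
theorem simpleStableIntegral_map (hM : IsStableRandomMeasure α m (fun _ => β) M P) {γ : Type*}
    (H : SimpleFunc B γ) (g : γ → ℝ) (hH : (H.map g).FinMeasSupp m) :
    ∀ᵐ ω ∂P, simpleStableIntegral M (H.map g) ω = ∑ c ∈ H.range, g c * M (H ⁻¹' {c}) ω := by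
  classical
  have hfin : ∀ v ≠ 0, ∀ c ∈ H.range.filter (fun c => g c = v), H ⁻¹' {c} ∈ finiteSets m := by
    intro v hv c hc
    refine ⟨H.measurableSet_preimage _, (measure_mono ?_).trans_lt
      (hH.meas_preimage_singleton_ne_zero hv)⟩
    intro x hx
    simp only [Set.mem_preimage, Set.mem_singleton_iff, SimpleFunc.map_apply] at hx ⊢
    rw [hx]
    exact (Finset.mem_filter.1 hc).2
  have hadd : ∀ᵐ ω ∂P, ∀ v ∈ (H.map g).range.filter (fun c => c ≠ 0),
      M ((H.map g) ⁻¹' {v}) ω = ∑ c ∈ H.range.filter (fun c => g c = v), M (H ⁻¹' {c}) ω := by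
    rw [Filter.eventually_all_finset]
    intro v hv
    have h := hM.apply_biUnion (H.range.filter (fun c => g c = v))
      (A := fun c => H ⁻¹' {c}) (hfin v (Finset.mem_filter.1 hv).2)
      (fun i j hij => Disjoint.preimage _ (by simpa using hij))
    have hU : ⋃ c ∈ H.range.filter (fun c => g c = v), H ⁻¹' {c} = (H.map g) ⁻¹' {v} := by
      ext x
      simp
    rwa [hU] at h
  filter_upwards [hadd] with ω hω
  have hz : ∑ c ∈ H.range, g c * M (H ⁻¹' {c}) ω
      = ∑ c ∈ H.range.filter (fun c => g c ≠ 0), g c * M (H ⁻¹' {c}) ω := by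
    rw [Finset.sum_filter]
    exact Finset.sum_congr rfl fun c _ => by split_ifs with h <;> simp_all
  rw [hz, simpleStableIntegral, ← Finset.sum_fiberwise_of_maps_to
    (t := (H.map g).range.filter (fun c => c ≠ 0)) (g := g)]
  · refine Finset.sum_congr rfl fun v hv => ?_
    rw [hω v hv, Finset.mul_sum, Finset.filter_filter]
    have hv0 := (Finset.mem_filter.1 hv).2
    have : H.range.filter (fun c => g c ≠ 0 ∧ g c = v) = H.range.filter (fun c => g c = v) :=
      Finset.filter_congr fun c _ => ⟨fun h => h.2, fun h => ⟨h ▸ hv0, h⟩⟩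
    rw [this]
    exact Finset.sum_congr rfl fun c hc => by rw [(Finset.mem_filter.1 hc).2]
  · intro c hc
    rw [Finset.mem_filter] at hc ⊢
    rw [SimpleFunc.range_map]
    exact ⟨Finset.mem_image_of_mem _ hc.1, hc.2⟩

/-- F, G and aF + bG are all functions of the pair (F, G), so the three integrals can be compared
term by term on the level sets of that pair. -/
theorem simpleStableIntegral_linear (hM : IsStableRandomMeasure α m (fun _ => β) M P)
    {F G : SimpleFunc B ℝ} (hF : F.FinMeasSupp m) (hG : G.FinMeasSupp m) (a b : ℝ) :
    ∀ᵐ ω ∂P, simpleStableIntegral M ((F.pair G).map fun p => a * p.1 + b * p.2) ω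
      = a * simpleStableIntegral M F ω + b * simpleStableIntegral M G ω := by
  have hp := hF.pair hG
  filter_upwards [hM.simpleStableIntegral_map (F.pair G) Prod.fst (hp.map rfl),
    hM.simpleStableIntegral_map (F.pair G) Prod.snd (hp.map rfl),
    hM.simpleStableIntegral_map (F.pair G) (fun p => a * p.1 + b * p.2) (hp.map (by simp))]
    with ω h1 h2 h3
  rw [SimpleFunc.map_fst_pair] at h1
  rw [SimpleFunc.map_snd_pair] at h2
  rw [h1, h2, h3, Finset.mul_sum, Finset.mul_sum, ← Finset.sum_add_distrib]
  exact Finset.sum_congr rfl fun c _ => by ring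

theorem mem_finiteSets_preimage {F : SimpleFunc B ℝ} (hF : F.FinMeasSupp m) {c : ℝ} (hc : c ≠ 0) :
    F ⁻¹' {c} ∈ finiteSets m :=
  ⟨F.measurableSet_preimage _, hF.meas_preimage_singleton_ne_zero hc⟩

theorem measurable_simpleStableIntegral (hM : IsStableRandomMeasure α m (fun _ => β) M P)
    {F : SimpleFunc B ℝ} (hF : F.FinMeasSupp m) : Measurable (simpleStableIntegral M F) :=
  Finset.measurable_sum _ fun _ hc =>
    (hM.measurable _ (mem_finiteSets_preimage hF (Finset.mem_filter.1 hc).2)).const_mul _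

theorem charFun_simpleStableIntegral [IsProbabilityMeasure P] (hα : 0 < α)
    (hM : IsStableRandomMeasure α m (fun _ => β) M P) {F : SimpleFunc B ℝ} (hF : F.FinMeasSupp m)
    (θ : ℝ) :
    charFun (P.map (simpleStableIntegral M F)) θ
      = Complex.exp (∫ x, levyExponent α β (θ * F x) ∂m) := by
  classical
  set s := F.range.filter (fun c => c ≠ 0) with hs
  have hmem : ∀ c ∈ s, F ⁻¹' {c} ∈ finiteSets m := fun c hc =>
    mem_finiteSets_preimage hF (Finset.mem_filter.1 hc).2
  have hind : iIndepFun (s.restrict fun c ω => c * M (F ⁻¹' {c}) ω) P := by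
    -- Independent scattering is stated for families over `Fin k`, so the nonzero values of F are
    -- enumerated and the enumeration is then undone.
    have h1 := hM.indep s.card (fun i => F ⁻¹' {(s.equivFin.symm i : ℝ)})
      (fun i => hmem _ (s.equivFin.symm i).2) (fun i j hij => Disjoint.preimage _ (by
        simpa [Subtype.ext_iff] using fun h => hij (s.equivFin.symm.injective (Subtype.ext h))))
    have h2 := h1.precomp s.equivFin.injective
    simp only [Equiv.symm_apply_apply] at h2
    exact h2.comp (fun c x => (c : ℝ) * x) fun c => measurable_const_mul _
  have hsum : simpleStableIntegral M F = fun ω => ∑ c ∈ s, c * M (F ⁻¹' {c}) ω := rfl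
  rw [hsum, hind.charFun_map_fun_finsetSum_eq_prod
    fun c hc => ((hM.measurable _ (hmem c hc)).const_mul _).aemeasurable, Finset.prod_apply]
  have hint : ∫ x, levyExponent α β (θ * F x) ∂m
      = ∑ c ∈ s, ((m (F ⁻¹' {c})).toReal : ℂ) * levyExponent α β (θ * c) := by
    have hmap : (fun x => levyExponent α β (θ * F x)) = F.map fun c => levyExponent α β (θ * c) :=
      rfl
    -- Vanishing of the exponent at 0 discards the zero level set, whose measure may be infinite.
    have hzero : levyExponent α β (θ * 0) = 0 := by rw [mul_zero, levyExponent_zero hα]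
    have hi : Integrable F m := SimpleFunc.integrable_iff_finMeasSupp.2 hF
    rw [hmap, ← SimpleFunc.integral_eq_integral _ (SimpleFunc.integrable_iff_finMeasSupp.2
      (hF.map hzero)), SimpleFunc.map_integral _ _ hi hzero, hs,
      Finset.sum_filter]
    refine Finset.sum_congr rfl fun c _ => ?_
    split_ifs with h
    · simp [Measure.real]
    · rw [not_not.1 h, hzero, smul_zero]
  rw [hint, Complex.exp_sum]
  refine Finset.prod_congr rfl fun c hc => ?_
  rw [charFun_map_mul_comp (hM.measurable _ (hmem c hc)).aemeasurable, hM.charFun_map hα (hmem c hc),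
    mul_comm c θ]

end IsStableRandomMeasure

end RandomMeasure

/-! ### The stable integral: existence, uniqueness, linearity. -/

section Integral

variable {Ω : Type*} [MeasurableSpace Ω] {P : Measure Ω}
  {B : Type*} [MeasurableSpace B] {m : Measure B} {α β : ℝ} {M : Set B → Ω → ℝ}

theorem IsStableRandomMeasure.tendstoInMeasure_simpleStableIntegral_zero [IsProbabilityMeasure P]
    (hα : 0 < α)
    (hM : IsStableRandomMeasure α m (fun _ => β) M P) {F : ℕ → SimpleFunc B ℝ} {g : B → ℝ}
    (hg : StableIntegrable α m (fun _ => β) g) (hF : ∀ k, (F k).FinMeasSupp m)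
    (hFg : ∀ k x, |F k x| ≤ |g x|) (hlim : ∀ᵐ x ∂m, Tendsto (fun k => F k x) atTop (𝓝 0)) :
    TendstoInMeasure P (fun k => simpleStableIntegral M (F k)) atTop 0 := by
  refine tendstoInMeasure_zero_of_tendsto_charFun
    (fun k => (hM.measurable_simpleStableIntegral (hF k)).aemeasurable) fun θ => ?_
  simp_rw [fun k => hM.charFun_simpleStableIntegral hα (hF k) θ]
  have h := tendsto_integral_levyExponent (f := fun _ => 0) (F := fun k x => θ * F k x) hα
    (hg.const_mul hα θ)
    (fun k => (F k).measurable.const_mul θ) (fun k x => by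
      rw [abs_mul, abs_mul]; exact mul_le_mul_of_nonneg_left (hFg k x) (abs_nonneg θ))
    (hlim.mono fun x hx => by simpa using hx.const_mul θ)
  simp only [levyExponent_zero hα, integral_zero] at h
  simpa [Function.comp_def] using (Complex.continuous_exp.tendsto 0).comp h

/-- The differences F - G are simple, dominated by |g| + |h| and tend to 0. This yields independence
of the approximating sequence, and, for two subsequences of one sequence, the Cauchy property behind
existence. -/
theorem IsStableRandomMeasure.tendstoInMeasure_simpleStableIntegral_sub [IsProbabilityMeasure P]
    (hα : 0 < α)
    (hM : IsStableRandomMeasure α m (fun _ => β) M P) {F G : ℕ → SimpleFunc B ℝ} {f g h : B → ℝ}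
    (hg : StableIntegrable α m (fun _ => β) g) (hh : StableIntegrable α m (fun _ => β) h)
    (hF : ∀ k, (F k).FinMeasSupp m) (hG : ∀ k, (G k).FinMeasSupp m)
    (hFg : ∀ k x, |F k x| ≤ |g x|) (hGh : ∀ k x, |G k x| ≤ |h x|)
    (hlimF : ∀ᵐ x ∂m, Tendsto (fun k => F k x) atTop (𝓝 (f x)))
    (hlimG : ∀ᵐ x ∂m, Tendsto (fun k => G k x) atTop (𝓝 (f x))) :
    TendstoInMeasure P (fun k => simpleStableIntegral M (F k) - simpleStableIntegral M (G k))
      atTop 0 := by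
  refine (hM.tendstoInMeasure_simpleStableIntegral_zero hα
    (F := fun k => ((F k).pair (G k)).map fun p => 1 * p.1 + (-1) * p.2) (hg.abs_add_abs hα hh)
    (fun k => ((hF k).pair (hG k)).map (by simp)) (fun k x => ?_) ?_).congr_left fun k => ?_
  · rw [abs_of_nonneg (add_nonneg (abs_nonneg (g x)) (abs_nonneg (h x)))]
    simp only [SimpleFunc.map_apply, SimpleFunc.pair_apply]
    have h1 := abs_add_le (1 * F k x) (-1 * G k x)
    rw [abs_mul, abs_mul] at h1
    simp only [abs_one, abs_neg, one_mul] at h1 ⊢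
    linarith [hFg k x, hGh k x]
  · filter_upwards [hlimF, hlimG] with x h1 h2
    simpa [sub_eq_add_neg] using h1.sub h2
  · filter_upwards [hM.simpleStableIntegral_linear (hF k) (hG k) 1 (-1)] with ω hω
    rw [hω, Pi.sub_apply]; ring

namespace HasStableIntegral

variable {f g : B → ℝ} {X Y : Ω → ℝ}

theorem tendstoInMeasure [IsProbabilityMeasure P]
    (hα : 0 < α) (hM : IsStableRandomMeasure α m (fun _ => β) M P)
    (hX : HasStableIntegral α m (fun _ => β) M P f X) {G : ℕ → SimpleFunc B ℝ} {h : B → ℝ}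
    (hh : StableIntegrable α m (fun _ => β) h) (hG : ∀ k, (G k).FinMeasSupp m)
    (hGh : ∀ k x, |G k x| ≤ |h x|)
    (hlimG : ∀ᵐ x ∂m, Tendsto (fun k => G k x) atTop (𝓝 (f x))) :
    TendstoInMeasure P (fun k => simpleStableIntegral M (G k)) atTop X := by
  obtain ⟨-, g, F, hg, hF, hFg, hlimF, hX⟩ := hX
  have h1 := (hM.tendstoInMeasure_simpleStableIntegral_sub hα hh hg hG hF hGh
    (fun k x => (hFg k x).trans (le_abs_self _)) hlimG hlimF).add hX
  simpa using h1

theorem ae_eq [IsProbabilityMeasure P]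
    (hα : 0 < α) (hM : IsStableRandomMeasure α m (fun _ => β) M P)
    (hX : HasStableIntegral α m (fun _ => β) M P f X)
    (hY : HasStableIntegral α m (fun _ => β) M P f Y) : X =ᵐ[P] Y := by
  obtain ⟨-, g, F, hg, hF, hFg, hlimF, hX'⟩ := hX
  exact tendstoInMeasure_ae_unique hX' (hY.tendstoInMeasure hα hM hg hF
    (fun k x => (hFg k x).trans (le_abs_self _)) hlimF)

theorem linear (hα : 0 < α) (hM : IsStableRandomMeasure α m (fun _ => β) M P)
    (hX : HasStableIntegral α m (fun _ => β) M P f X)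
    (hY : HasStableIntegral α m (fun _ => β) M P g Y) (a b : ℝ) :
    HasStableIntegral α m (fun _ => β) M P (fun x => a * f x + b * g x)
      (fun ω => a * X ω + b * Y ω) := by
  obtain ⟨hXm, h, F, hh, hF, hFh, hlimF, hX⟩ := hX
  obtain ⟨hYm, l, G, hl, hG, hGl, hlimG, hY⟩ := hY
  refine ⟨(hXm.const_mul a).add (hYm.const_mul b), _,
    fun k => ((F k).pair (G k)).map fun p => a * p.1 + b * p.2,
    (hh.const_mul hα a).abs_add_abs hα (hl.const_mul hα b),
    fun k => ((hF k).pair (hG k)).map (by simp), fun k x => ?_, ?_, ?_⟩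
  · refine (abs_add_le _ _).trans (add_le_add ?_ ?_) <;>
      simp only [SimpleFunc.pair_apply, abs_mul]
    · exact mul_le_mul_of_nonneg_left ((hFh k x).trans (le_abs_self _)) (abs_nonneg a)
    · exact mul_le_mul_of_nonneg_left ((hGl k x).trans (le_abs_self _)) (abs_nonneg b)
  · filter_upwards [hlimF, hlimG] with x h1 h2
    exact (h1.const_mul a).add (h2.const_mul b)
  · refine ((hX.const_mul a).add (hY.const_mul b)).congr_left fun k => ?_
    filter_upwards [hM.simpleStableIntegral_linear (hF k) (hG k) a b] with ω hω
    rw [hω, Pi.add_apply]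

theorem zero (hα : 0 < α) : HasStableIntegral α m (fun _ => β) M P (fun _ => 0) (fun _ => 0) := by
  refine ⟨aemeasurable_const, fun _ => 0, fun _ => 0, ?_, fun k => ?_, fun k x => by simp,
    ae_of_all _ fun x => ?_, ?_⟩
  · rw [stableIntegrable_iff_integrable_admissibleBound]
    refine ⟨measurable_const, ?_⟩
    simp [admissibleBound, Real.zero_rpow hα.ne']
  · simp [SimpleFunc.finMeasSupp_iff_support]
  · simp
  · have h0 : simpleStableIntegral M (0 : SimpleFunc B ℝ) = fun _ => (0 : ℝ) := by
      ext ω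
      refine Finset.sum_eq_zero fun c hc => absurd ?_ (Finset.mem_filter.1 hc).2
      obtain ⟨x, hx⟩ := SimpleFunc.mem_range.1 (Finset.mem_filter.1 hc).1
      exact hx.symm
    simp only [h0]
    rw [tendstoInMeasure_iff_norm]
    intro ε hε
    simp [not_le.2 hε]

theorem finsetSum (hα : 0 < α) (hM : IsStableRandomMeasure α m (fun _ => β) M P) {ι : Type*}
    (s : Finset ι) (c : ι → ℝ) {f : ι → B → ℝ} {X : ι → Ω → ℝ}
    (hX : ∀ i ∈ s, HasStableIntegral α m (fun _ => β) M P (f i) (X i)) :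
    HasStableIntegral α m (fun _ => β) M P (fun x => ∑ i ∈ s, c i * f i x)
      (fun ω => ∑ i ∈ s, c i * X i ω) := by
  classical
  induction s using Finset.induction with
  | empty => simpa using zero hα
  | insert i s hi ih =>
    simp_rw [Finset.sum_insert hi]
    simpa using (hX i (by simp)).linear hα hM (ih fun j hj => hX j (by simp [hj])) (c i) 1

theorem stableIntegral (hX : HasStableIntegral α m (fun _ => β) M P f X) :
    HasStableIntegral α m (fun _ => β) M P f (stableIntegral α m (fun _ => β) M P f) := by
  have h : ∃ X : Ω → ℝ, HasStableIntegral α m (fun _ => β) M P f X := ⟨X, hX⟩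
  rw [_root_.stableIntegral, dif_pos h]
  exact h.choose_spec

end HasStableIntegral

theorem IsStableRandomMeasure.exists_hasStableIntegral [IsProbabilityMeasure P]
    [SigmaFinite m] (hα : 0 < α)
    (hM : IsStableRandomMeasure α m (fun _ => β) M P) {f : B → ℝ}
    (hf : StableIntegrable α m (fun _ => β) f) :
    ∃ X : Ω → ℝ, HasStableIntegral α m (fun _ => β) M P f X := by
  let A : ℕ → SimpleFunc B ℝ := SimpleFunc.approxOn f hf.measurable Set.univ 0 trivial
  -- Cutting off to the spanning sets secures support of finite measure and leaves each point
  -- untouched from some index on.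
  let F : ℕ → SimpleFunc B ℝ := fun k => (A k).restrict (spanningSets m k)
  have hFx : ∀ k x, F k x = (spanningSets m k).indicator (A k) x := fun k x =>
    SimpleFunc.restrict_apply _ (measurableSet_spanningSets m k) x
  have hF : ∀ k, (F k).FinMeasSupp m := fun k => by
    rw [SimpleFunc.finMeasSupp_iff_support]
    refine (measure_mono fun x hx => ?_).trans_lt (measure_spanningSets_lt_top m k)
    by_contra hc
    exact hx (by rw [hFx, Set.indicator_of_notMem hc])
  -- The factor 2 comes from the bound |A k x| ≤ |f x| + |f x| for the standard approximants.
  have h2f := (hf.const_mul hα 2)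
  have hFg : ∀ k x, |F k x| ≤ |2 * f x| := fun k x => by
    rw [hFx]
    have h1 := SimpleFunc.norm_approxOn_zero_le hf.measurable (s := Set.univ) trivial x k
    have h2 := norm_indicator_le_norm_self (s := spanningSets m k) (A k) x
    rw [abs_mul, abs_two, two_mul]
    exact h2.trans h1
  have hlim : ∀ x, Tendsto (fun k => F k x) atTop (𝓝 (f x)) := fun x => by
    have h1 : Tendsto (fun k => A k x) atTop (𝓝 (f x)) :=
      SimpleFunc.tendsto_approxOn hf.measurable (s := Set.univ) trivial (by simp)
    refine h1.congr' ?_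
    filter_upwards [eventually_ge_atTop (spanningSetsIndex m x)] with k hk
    rw [hFx, Set.indicator_of_mem (mem_spanningSets_of_index_le m x hk)]
  obtain ⟨X, hX, hlimX⟩ := exists_tendstoInMeasure_of_cauchy (P := P)
    (X := fun k => simpleStableIntegral M (F k))
    (fun k => (hM.measurable_simpleStableIntegral (hF k)).aemeasurable) fun a b ha hb =>
      hM.tendstoInMeasure_simpleStableIntegral_sub hα h2f h2f (F := fun k => F (a k))
        (G := fun k => F (b k)) (fun k => hF _) (fun k => hF _) (fun k => hFg _) (fun k => hFg _)
        (ae_of_all _ fun x => (hlim x).comp ha) (ae_of_all _ fun x => (hlim x).comp hb)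
  exact ⟨X, hX, fun x => |2 * f x|, F, h2f.mono hα h2f.measurable.abs fun x => (abs_abs _).le, hF,
    hFg, ae_of_all _ hlim, hlimX⟩

end Integral

/-! ### Sums of integrals against independent noises. -/

section Noise

variable {Ω : Type*} [MeasurableSpace Ω] {P : Measure Ω} {n : ℕ}
  {α κ : ℝ} {β : Fin n → ℝ} {M : Fin n → Set ℝ≥0 → Ω → ℝ}

/-- Each integral is a measurable function φ of the whole family A ↦ M j A, and these families are
independent. The sum is taken over `attach` because φ needs the proof that each level set has finite
measure. -/
theorem IsStableNoise.iIndepFun_simpleStableIntegral (hM : IsStableNoise α κ β M P)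
    {F : Fin n → SimpleFunc ℝ≥0 ℝ} (hF : ∀ j, (F j).FinMeasSupp (controlMeasure κ)) :
    iIndepFun (fun j => simpleStableIntegral (M j) (F j)) P := by
  classical
  let φ : Fin n → (finiteSets (controlMeasure κ) → ℝ) → ℝ := fun j w =>
    ∑ c ∈ ((F j).range.filter (fun c => c ≠ 0)).attach,
      (c : ℝ) * w ⟨F j ⁻¹' {(c : ℝ)}, IsStableRandomMeasure.mem_finiteSets_preimage (hF j)
        (Finset.mem_filter.1 c.2).2⟩
  have h := hM.indep.comp φ fun j =>
    Finset.measurable_sum _ fun c _ => (measurable_pi_apply _).const_mul _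
  convert! h using 2 with j
  ext ω
  simp only [φ, simpleStableIntegral]
  exact (Finset.sum_attach _ fun c => c * M j (F j ⁻¹' {c}) ω).symm

/-- The characteristic function at `1` of a sum of stable integrals against the components of the
noise. -/
theorem IsStableNoise.charFun_map_sum [IsProbabilityMeasure P]
    (hα : 0 < α) (hM : IsStableNoise α κ β M P)
    {f : Fin n → ℝ≥0 → ℝ} {X : Fin n → Ω → ℝ}
    (hX : ∀ j, HasStableIntegral α (controlMeasure κ) (fun _ => β j) (M j) P (f j) (X j)) :
    charFun (P.map (∑ j, X j)) 1
      = Complex.exp (∑ j, ∫ s, levyExponent α (β j) (f j s) ∂(controlMeasure κ)) := by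
  choose hXm g F hg hF hFg hlimF hXF using hX
  have hmeas : ∀ j k, AEMeasurable (simpleStableIntegral (M j) (F j k)) P := fun j k =>
    ((hM.isStableRandomMeasure j).measurable_simpleStableIntegral (hF j k)).aemeasurable
  have hlim := (TendstoInMeasure.finsetSum Finset.univ
    (X := fun j k => simpleStableIntegral (M j) (F j k)) fun j _ => hXF j).tendsto_charFun
    (fun k => Finset.aemeasurable_sum _ fun j _ => hmeas j k) 1
  refine tendsto_nhds_unique hlim ?_
  have hk : ∀ k, charFun (P.map (∑ j, simpleStableIntegral (M j) (F j k))) 1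
      = Complex.exp (∑ j, ∫ s, levyExponent α (β j) (F j k s) ∂(controlMeasure κ)) := fun k => by
    rw [(hM.iIndepFun_simpleStableIntegral fun j => hF j k).charFun_map_sum_eq_prod
      (fun j => hmeas j k), Finset.prod_apply, Complex.exp_sum]
    refine Finset.prod_congr rfl fun j _ => ?_
    rw [(hM.isStableRandomMeasure j).charFun_simpleStableIntegral hα (hF j k)]
    simp
  simp_rw [hk]
  refine (Complex.continuous_exp.tendsto _).comp (tendsto_finsetSum _ fun j _ => ?_)
  exact tendsto_integral_levyExponent hα (hg j) (fun k => (F j k).measurable)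
    (fun k x => (hFg j k x).trans (le_abs_self _)) (hlimF j)

end Noise

/-! ### Spectral theory of the Laplacian. -/

section Network

variable {n : ℕ} {G : SimpleGraph (Fin n)} {a : Fin n → Fin n → ℝ}
  {Q : Matrix (Fin n) (Fin n) ℝ} {lam : Fin n → ℝ}

theorem IsCoupling.laplacian_mulVec (ha : IsCoupling G a) (v : Fin n → ℝ) (i : Fin n) :
    (laplacian a *ᵥ v) i = ∑ j, a i j * (v i - v j) := by
  have h : ∀ j, laplacian a i j * v j = (if i = j then (∑ k, a i k) * v i else 0) - a i j * v j := by
    intro j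
    rcases eq_or_ne i j with rfl | hij
    · simp [laplacian, ha.zero i i (G.loopless.irrefl i)]
    · simp [laplacian, hij]
  simp only [mulVec, dotProduct, h, mul_sub, Finset.sum_sub_distrib, Finset.sum_ite_eq,
    Finset.mem_univ, if_true, Finset.sum_mul]

theorem IsCoupling.dotProduct_laplacian_mulVec (ha : IsCoupling G a) (v : Fin n → ℝ) :
    2 * (v ⬝ᵥ laplacian a *ᵥ v) = ∑ i, ∑ j, a i j * (v i - v j) ^ 2 := by
  have h1 : v ⬝ᵥ laplacian a *ᵥ v = ∑ i, ∑ j, a i j * (v i - v j) * v i := by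
    simp only [dotProduct, ha.laplacian_mulVec, Finset.mul_sum]
    exact Finset.sum_congr rfl fun i _ => Finset.sum_congr rfl fun j _ => by ring
  have h2 : v ⬝ᵥ laplacian a *ᵥ v = -∑ i, ∑ j, a i j * (v i - v j) * v j := by
    rw [h1, Finset.sum_comm, ← Finset.sum_neg_distrib]
    refine Finset.sum_congr rfl fun i _ => ?_
    rw [← Finset.sum_neg_distrib]
    exact Finset.sum_congr rfl fun j _ => by rw [ha.symm j i]; ring
  rw [two_mul]
  nth_rw 1 [h1]
  rw [h2, ← sub_eq_add_neg, ← Finset.sum_sub_distrib]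
  refine Finset.sum_congr rfl fun i _ => ?_
  rw [← Finset.sum_sub_distrib]
  exact Finset.sum_congr rfl fun j _ => by ring

theorem IsCoupling.nonneg (ha : IsCoupling G a) (i j : Fin n) : 0 ≤ a i j := by
  by_cases h : G.Adj i j
  · exact (ha.pos i j h).le
  · exact (ha.zero i j h).ge

/-- The Dirichlet form is a sum of nonnegative terms, so all vanish and v agrees across every link;
a walk joins any two nodes. -/
theorem IsCoupling.eq_of_dotProduct_laplacian_nonpos (ha : IsCoupling G a) (hG : G.Connected)
    {v : Fin n → ℝ} (hv : v ⬝ᵥ laplacian a *ᵥ v ≤ 0) (i j : Fin n) : v i = v j := by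
  have hterm : ∀ i j, 0 ≤ a i j * (v i - v j) ^ 2 := fun i j =>
    mul_nonneg (ha.nonneg i j) (sq_nonneg _)
  have hsum : ∑ i, ∑ j, a i j * (v i - v j) ^ 2 = 0 :=
    le_antisymm (by rw [← ha.dotProduct_laplacian_mulVec]; linarith)
      (Finset.sum_nonneg fun i _ => Finset.sum_nonneg fun j _ => hterm i j)
  have hadj : ∀ i j, G.Adj i j → v i = v j := by
    intro i j hij
    have h1 := (Finset.sum_eq_zero_iff_of_nonneg
      (fun i _ => Finset.sum_nonneg fun j _ => hterm i j)).1 hsum i (Finset.mem_univ i)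
    have h2 := (Finset.sum_eq_zero_iff_of_nonneg (fun j _ => hterm i j)).1 h1 j (Finset.mem_univ j)
    rcases mul_eq_zero.1 h2 with h | h
    · exact absurd h (ha.pos i j hij).ne'
    · exact sub_eq_zero.1 (pow_eq_zero_iff two_ne_zero |>.1 h)
  obtain ⟨w⟩ := hG.preconnected i j
  induction w with
  | nil => rfl
  | cons h _ ih => exact (hadj _ _ h).trans ih

theorem laplacian_mulVec_col (hQ : Qᵀ * Q = 1) (hL : laplacian a = Q * diagonal lam * Qᵀ)
    (k : Fin n) : laplacian a *ᵥ Q.col k = lam k • Q.col k := by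
  have h : laplacian a * Q = Q * diagonal lam := by
    rw [hL, Matrix.mul_assoc, hQ, Matrix.mul_one]
  ext i
  have := congrFun (congrFun h i) k
  rw [Matrix.mul_diagonal] at this
  simpa [Matrix.mul_apply, mulVec, dotProduct, mul_comm] using this

theorem col_dotProduct_col (hQ : Qᵀ * Q = 1) (k l : Fin n) :
    Q.col k ⬝ᵥ Q.col l = if k = l then 1 else 0 := by
  rw [← Matrix.one_apply, ← hQ]
  rfl

/-- The Dirichlet energy of a unit eigenvector is its eigenvalue. -/
theorem IsCoupling.col_eq_of_nonpos (ha : IsCoupling G a) (hG : G.Connected) (hQ : Qᵀ * Q = 1)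
    (hL : laplacian a = Q * diagonal lam * Qᵀ) {k : Fin n} (hk : lam k ≤ 0) (i j : Fin n) :
    Q i k = Q j k := by
  refine ha.eq_of_dotProduct_laplacian_nonpos hG (v := Q.col k) ?_ i j
  rw [laplacian_mulVec_col hQ hL, dotProduct_smul, col_dotProduct_col hQ]
  simpa using hk

/-- Were the smallest eigenvalue positive, L would be injective, yet it kills the constants. -/
theorem IsCoupling.lam_nonpos_of_val_eq_zero (ha : IsCoupling G a) (hQ : Qᵀ * Q = 1)
    (hlam : Monotone lam) (hL : laplacian a = Q * diagonal lam * Qᵀ) {k : Fin n}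
    (hk : (k : ℕ) = 0) : lam k ≤ 0 := by
  by_contra! hpos
  have hpos' : ∀ l, lam l ≠ 0 := fun l =>
    (hpos.trans_le (hlam (Fin.le_def.2 (by omega)))).ne'
  have h1 : laplacian a *ᵥ (fun _ => (1 : ℝ)) = 0 := by
    ext i; simp [ha.laplacian_mulVec]
  have h2 : diagonal lam *ᵥ (Qᵀ *ᵥ fun _ => (1 : ℝ)) = 0 := by
    have h3 : diagonal lam * Qᵀ = Qᵀ * laplacian a := by
      rw [hL, ← Matrix.mul_assoc, ← Matrix.mul_assoc, hQ, Matrix.one_mul]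
    rw [mulVec_mulVec, h3, ← mulVec_mulVec, h1, mulVec_zero]
  have h4 : Qᵀ *ᵥ (fun _ => (1 : ℝ)) = 0 := by
    ext l
    have := congrFun h2 l
    rw [mulVec_diagonal] at this
    exact (mul_eq_zero.1 this).resolve_left (hpos' l)
  have h5 : (fun _ => (1 : ℝ)) = (0 : Fin n → ℝ) := by
    have h6 : Q *ᵥ (Qᵀ *ᵥ fun _ => (1 : ℝ)) = fun _ => 1 := by
      rw [mulVec_mulVec, mul_eq_one_comm.1 hQ, one_mulVec]
    rw [← h6, h4, mulVec_zero]
  exact one_ne_zero (congrFun h5 k)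

/-- A second nonpositive eigenvalue would give two constant columns of Q, which cannot be both
orthogonal and of norm one. -/
theorem IsCoupling.lam_pos (ha : IsCoupling G a) (hG : G.Connected) (hQ : Qᵀ * Q = 1)
    (hlam : Monotone lam) (hL : laplacian a = Q * diagonal lam * Qᵀ) {k : Fin n}
    (hk : (k : ℕ) ≠ 0) : 0 < lam k := by
  by_contra! hneg
  let z : Fin n := ⟨0, by omega⟩
  have h0 := ha.lam_nonpos_of_val_eq_zero hQ hlam hL (k := z) rfl
  have hcol : ∀ {l}, lam l ≤ 0 → Q.col l = fun _ => Q z l := fun {l} hl => by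
    ext i; exact ha.col_eq_of_nonpos hG hQ hL hl i z
  have h1 := col_dotProduct_col hQ z z
  have h2 := col_dotProduct_col hQ k k
  have h3 := col_dotProduct_col hQ z k
  have hne : z ≠ k := fun h => hk (h ▸ rfl)
  rw [hcol h0] at h1 h3
  rw [hcol hneg] at h2 h3
  simp [dotProduct, hne] at h1 h2 h3
  rcases h3 with h | h | h <;> simp [h] at h1 h2

/-- The first column is constant of norm one, so its entries square to 1/n and its projection is
(1/n) 𝟏𝟏ᵀ; this is subtracted from Q Qᵀ = I. -/
theorem IsCoupling.centering_eq (ha : IsCoupling G a) (hG : G.Connected) (hQ : Qᵀ * Q = 1)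
    (hlam : Monotone lam) (hL : laplacian a = Q * diagonal lam * Qᵀ) :
    centering n = Q * diagonal (fun k : Fin n => if (k : ℕ) = 0 then 0 else 1) * Qᵀ := by
  have hn : 0 < n := Fin.pos (hG.nonempty.some)
  let z : Fin n := ⟨0, hn⟩
  have hz : ∀ k : Fin n, (k : ℕ) = 0 ↔ k = z := fun k => by simp [Fin.ext_iff, z]
  have h0 := ha.lam_nonpos_of_val_eq_zero hQ hlam hL (k := z) rfl
  have hcol : ∀ i, Q i z = Q z z := fun i => ha.col_eq_of_nonpos hG hQ hL h0 i z
  have h1 : (n : ℝ) * (Q z z * Q z z) = 1 := by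
    have := col_dotProduct_col hQ z z
    simpa [dotProduct, hcol] using this
  have hsq : Q z z * Q z z = 1 / (n : ℝ) := by
    rw [eq_div_iff (by positivity), mul_comm, h1]
  have hdiag : diagonal (fun k : Fin n => if (k : ℕ) = 0 then (0 : ℝ) else 1)
      = 1 - diagonal (Pi.single z 1) := by
    rw [← diagonal_one, diagonal_sub]
    congr 1
    ext k
    by_cases h : k = z <;> simp [hz, h]
  rw [hdiag, Matrix.mul_sub, Matrix.sub_mul, Matrix.mul_one, mul_eq_one_comm.1 hQ, centering]
  congr 1
  ext i j
  rw [Matrix.mul_apply, Finset.sum_eq_single z]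
  · simp [hcol, hsq]
  · intro k _ hk
    simp [hk]
  · simp

theorem exp_neg_smul_laplacian (hQ : Qᵀ * Q = 1) (hL : laplacian a = Q * diagonal lam * Qᵀ)
    (u : ℝ) : NormedSpace.exp (-u • laplacian a)
      = Q * diagonal (fun k => Real.exp (-lam k * u)) * Qᵀ := by
  have hinv : Q⁻¹ = Qᵀ := Matrix.inv_eq_left_inv hQ
  have hu : IsUnit Q := IsUnit.of_mul_eq_one_right _ hQ
  have h : -u • laplacian a = Q * diagonal (fun k => -lam k * u) * Q⁻¹ := by
    rw [hL, hinv, ← Matrix.smul_mul, ← Matrix.mul_smul, ← diagonal_smul]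
    congr 3
    ext k
    simp [mul_comm]
  rw [h, Matrix.exp_conj _ _ hu, Matrix.exp_diagonal, hinv]
  congr 3
  ext k
  rw [Pi.coe_exp, Real.exp_eq_exp_ℝ]

theorem IsCoupling.centering_mul_exp (ha : IsCoupling G a) (hG : G.Connected) (hQ : Qᵀ * Q = 1)
    (hlam : Monotone lam) (hL : laplacian a = Q * diagonal lam * Qᵀ) (u : ℝ) :
    centering n * NormedSpace.exp (-u • laplacian a) = Q * Phi lam u * Qᵀ := by
  rw [ha.centering_eq hG hQ hlam hL, exp_neg_smul_laplacian hQ hL]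
  simp only [Matrix.mul_assoc]
  rw [← Matrix.mul_assoc Qᵀ, hQ, Matrix.one_mul, ← Matrix.mul_assoc (diagonal _), diagonal_mul_diagonal,
    Phi]
  congr 3
  ext k
  by_cases h : (k : ℕ) = 0 <;> simp [h]

theorem IsCoupling.mul_Phi_mul_centering (ha : IsCoupling G a) (hG : G.Connected) (hQ : Qᵀ * Q = 1)
    (hlam : Monotone lam) (hL : laplacian a = Q * diagonal lam * Qᵀ) (u : ℝ) :
    Q * Phi lam u * Qᵀ * centering n = Q * Phi lam u * Qᵀ := by
  rw [ha.centering_eq hG hQ hlam hL]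
  simp only [Matrix.mul_assoc]
  rw [← Matrix.mul_assoc Qᵀ, hQ, Matrix.one_mul, ← Matrix.mul_assoc (Phi lam u), Phi,
    diagonal_mul_diagonal]
  congr 3
  ext k
  by_cases h : (k : ℕ) = 0 <;> simp [h]

theorem mul_Phi_mul_apply (u : ℝ) (i j : Fin n) :
    (Q * Phi lam u * Qᵀ) i j = spectralFun Q lam i j u := by
  rw [Phi, Matrix.mul_apply, spectralFun, Finset.sum_filter]
  refine Finset.sum_congr rfl fun k _ => ?_
  rw [mul_diagonal, transpose_apply]
  by_cases h : (k : ℕ) = 0 <;> simp [h]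
  ring

theorem continuous_spectralFun (i j : Fin n) : Continuous (spectralFun Q lam i j) := by
  unfold spectralFun
  fun_prop

theorem exists_abs_spectralFun_le (hlam : ∀ k : Fin n, (k : ℕ) ≠ 0 → 0 < lam k) :
    ∃ C > 0, ∃ γ > 0, ∀ i j, ∀ u ≥ 0, |spectralFun Q lam i j u| ≤ C * Real.exp (-γ * u) := by
  obtain ⟨γ, hγ, hγlam⟩ : ∃ γ > 0, ∀ k : Fin n, (k : ℕ) ≠ 0 → γ ≤ lam k := by
    -- The rate γ is the smallest eigenvalue of nonzero index; if there is no such index, the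
    -- kernels vanish and any rate will do.
    rcases (Finset.univ.filter fun k : Fin n => (k : ℕ) ≠ 0).eq_empty_or_nonempty with h | h
    · exact ⟨1, one_pos, fun k hk =>
        absurd hk (Finset.filter_eq_empty_iff.1 h (Finset.mem_univ k))⟩
    · obtain ⟨k₀, hk₀, hmin⟩ := Finset.exists_min_image _ lam h
      exact ⟨lam k₀, hlam _ (Finset.mem_filter.1 hk₀).2, fun k hk => hmin k (by simpa using hk)⟩
  -- Summing over all i, j makes C uniform in the entry, and the leading 1 makes it positive.
  refine ⟨1 + ∑ i, ∑ j, ∑ k, |Q i k * Q j k|, by positivity, γ, hγ, fun i j u hu => ?_⟩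
  have h1 : |spectralFun Q lam i j u| ≤ ∑ k, |Q i k * Q j k| * Real.exp (-γ * u) := by
    rw [spectralFun, Finset.sum_filter]
    refine (Finset.abs_sum_le_sum_abs _ _).trans (Finset.sum_le_sum fun k _ => ?_)
    split_ifs with h
    · rw [abs_mul, Real.abs_exp]
      gcongr
      exact hγlam k h
    · simp only [abs_zero]; positivity
  refine h1.trans ?_
  rw [← Finset.sum_mul]
  refine mul_le_mul_of_nonneg_right ?_ (Real.exp_pos _).le
  have h2 : ∑ k, |Q i k * Q j k| ≤ ∑ j, ∑ k, |Q i k * Q j k| :=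
    Finset.single_le_sum (f := fun j => ∑ k, |Q i k * Q j k|)
      (fun j _ => by positivity) (Finset.mem_univ j)
  have h3 : ∑ j, ∑ k, |Q i k * Q j k| ≤ ∑ i, ∑ j, ∑ k, |Q i k * Q j k| :=
    Finset.single_le_sum (f := fun i => ∑ j, ∑ k, |Q i k * Q j k|)
      (fun j _ => by positivity) (Finset.mem_univ i)
  linarith

end Network

/-! ### Integration on the half-line and exponentially decaying kernels. -/

section ControlMeasure

variable {κ : ℝ}

theorem measurableEmbedding_coe_nnreal : MeasurableEmbedding ((↑) : ℝ≥0 → ℝ) :=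
  MeasurableEmbedding.subtype_coe (s := Set.Ici (0 : ℝ)) measurableSet_Ici

theorem map_controlMeasure :
    (controlMeasure κ).map ((↑) : ℝ≥0 → ℝ) = ENNReal.ofReal κ • volume.restrict (Set.Ioi 0) := by
  have hr : Set.range ((↑) : ℝ≥0 → ℝ) = Set.Ici 0 := Subtype.range_coe
  rw [controlMeasure, Measure.map_smul, measurableEmbedding_coe_nnreal.map_comap, hr,
    Measure.restrict_congr_set Ioi_ae_eq_Ici]

theorem integral_controlMeasure (hκ : 0 < κ) (G : ℝ → ℂ) :
    ∫ s : ℝ≥0, G s ∂(controlMeasure κ) = κ * ∫ s in Set.Ioi 0, G s := by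
  rw [← measurableEmbedding_coe_nnreal.integral_map, map_controlMeasure, integral_smul_measure,
    ENNReal.toReal_ofReal hκ.le, Complex.real_smul]

theorem integrable_controlMeasure_iff (hκ : 0 < κ) (G : ℝ → ℝ) :
    Integrable (fun s : ℝ≥0 => G s) (controlMeasure κ) ↔ IntegrableOn G (Set.Ioi 0) := by
  have h := measurableEmbedding_coe_nnreal.integrable_map_iff (μ := controlMeasure κ) (g := G)
  rw [map_controlMeasure, integrable_smul_measure (by simpa using hκ) ENNReal.ofReal_ne_top] at h
  exact h.symm

instance sigmaFinite_controlMeasure : SigmaFinite (controlMeasure κ) := by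
  refine SigmaFinite.of_map _ measurableEmbedding_coe_nnreal.measurable.aemeasurable ?_
  rw [map_controlMeasure]
  exact inferInstanceAs (SigmaFinite (κ.toNNReal • volume.restrict (Set.Ioi (0 : ℝ))))

/-- Reflection s ↦ t - s trades the moving kernel for a fixed one on (0, t]; `hG` removes the
contribution of times after t. -/
theorem integral_convKernel (hκ : 0 < κ) {G : ℝ → ℂ} (hG : G 0 = 0) (h : ℝ → ℝ) (t : ℝ≥0) :
    ∫ s, G (convKernel h t s) ∂(controlMeasure κ) = κ * ∫ s in Set.Ioc 0 (t : ℝ), G (h s) := by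
  have h1 : ∀ s : ℝ≥0, G (convKernel h t s)
      = (Set.Iic (t : ℝ)).indicator (fun r => G (h (t - r))) (s : ℝ) := by
    intro s
    by_cases hs : s ≤ t
    · simp [convKernel, hs]
    · simp [convKernel, hs, hG]
  simp_rw [h1]
  rw [integral_controlMeasure hκ, integral_indicator measurableSet_Iic,
    Measure.restrict_restrict measurableSet_Iic, Set.inter_comm, Set.Ioi_inter_Iic,
    ← intervalIntegral.integral_of_le t.coe_nonneg, ← intervalIntegral.integral_of_le t.coe_nonneg,
    intervalIntegral.integral_comp_sub_left (fun u => G (h u))]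
  simp

theorem stableIntegrable_convKernel {α β : ℝ} (hα : 0 < α) (hκ : 0 < κ) {h : ℝ → ℝ}
    (hh : Continuous h) (t : ℝ≥0) :
    StableIntegrable α (controlMeasure κ) (fun _ => β) (convKernel h t) := by
  rw [stableIntegrable_iff_integrable_admissibleBound]
  constructor
  · exact Measurable.ite measurableSet_Iic (by fun_prop) measurable_const
  have h1 : ∀ s : ℝ≥0, admissibleBound α β (convKernel h t s)
      = (Set.Iic (t : ℝ)).indicator (fun r => admissibleBound α β (h (t - r))) (s : ℝ) := by
    intro s
    by_cases hs : s ≤ t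
    · simp [convKernel, hs]
    · simp [convKernel, hs, admissibleBound, Real.zero_rpow hα.ne']
  simp_rw [h1]
  rw [integrable_controlMeasure_iff hκ, IntegrableOn, integrable_indicator_iff measurableSet_Iic,
    IntegrableOn, Measure.restrict_restrict measurableSet_Iic, Set.inter_comm, Set.Ioi_inter_Iic]
  have hc : Continuous fun r => admissibleBound α β (h (t - r)) :=
    (continuous_admissibleBound hα).comp (by fun_prop)
  exact (hc.continuousOn.integrableOn_Icc (a := (0 : ℝ)) (b := t)).mono_set Set.Ioc_subset_Icc_self

theorem stableIntegrable_const_mul_exp {α β C γ : ℝ} (hα : 0 < α) (hC : 0 < C) (hγ : 0 < γ) :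
    StableIntegrable α (volume.restrict (Set.Ioi (0 : ℝ))) (fun _ => β)
      (fun s => C * Real.exp (-γ * s)) := by
  have hpos : ∀ s, 0 < C * Real.exp (-γ * s) := fun s => by positivity
  refine ⟨by fun_prop, ?_, fun _ => Integrable.const_mul ?_ β⟩
  · have h : ∀ s, |C * Real.exp (-γ * s)| ^ α = C ^ α * Real.exp (-(γ * α) * s) := fun s => by
      rw [abs_of_pos (hpos s), Real.mul_rpow hC.le (Real.exp_pos _).le, ← Real.exp_mul]
      ring_nf
    simp_rw [h]
    exact (exp_neg_integrableOn_Ioi 0 (by positivity)).const_mul _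
  -- The logarithm of the kernel grows linearly, and half of the decay pays for it: x ≤ e^x at x =
  -- γs/2 gives γs e^{-γs/2} ≤ 2.
  · refine ((exp_neg_integrableOn_Ioi 0 (half_pos hγ)).const_mul (C * (|Real.log C| + 2))).mono'
      ?_ ?_
    · exact ((by fun_prop : Measurable fun s => C * Real.exp (-γ * s)).mul
        (Real.measurable_log.comp (by fun_prop))).aestronglyMeasurable
    · filter_upwards [ae_restrict_mem measurableSet_Ioi] with s hs
      have hs0 : 0 < s := hs
      rw [abs_of_pos (hpos s), Real.log_mul hC.ne' (Real.exp_pos _).ne', Real.log_exp, norm_mul,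
        Real.norm_of_nonneg (hpos s).le, Real.norm_eq_abs]
      have h1 : Real.exp (-γ * s) = Real.exp (-(γ / 2) * s) * Real.exp (-(γ / 2) * s) := by
        rw [← Real.exp_add]; ring_nf
      have h2 : |Real.log C + -γ * s| ≤ |Real.log C| + γ * s := by
        refine (abs_add_le _ _).trans_eq ?_
        rw [neg_mul, abs_neg, abs_of_pos (mul_pos hγ hs0)]
      have h3 : Real.exp (-(γ / 2) * s) * (|Real.log C| + γ * s) ≤ |Real.log C| + 2 := by
        have h4 : γ / 2 * s ≤ Real.exp (γ / 2 * s) :=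
          (le_add_of_nonneg_right zero_le_one).trans (Real.add_one_le_exp _)
        have h5 : Real.exp (-(γ / 2) * s) * Real.exp (γ / 2 * s) = 1 := by
          rw [← Real.exp_add]; simp
        have h6 : Real.exp (-(γ / 2) * s) ≤ 1 := Real.exp_le_one_iff.2 (by nlinarith)
        have h7 := mul_le_mul_of_nonneg_left h4 (Real.exp_pos (-(γ / 2) * s)).le
        rw [h5] at h7
        nlinarith [mul_le_mul_of_nonneg_right h6 (abs_nonneg (Real.log C))]
      calc C * Real.exp (-γ * s) * |Real.log C + -γ * s|
          ≤ C * Real.exp (-γ * s) * (|Real.log C| + γ * s) :=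
            mul_le_mul_of_nonneg_left h2 (hpos s).le
        _ = C * Real.exp (-(γ / 2) * s) * (Real.exp (-(γ / 2) * s) * (|Real.log C| + γ * s)) := by
            rw [h1]; ring
        _ ≤ C * Real.exp (-(γ / 2) * s) * (|Real.log C| + 2) :=
            mul_le_mul_of_nonneg_left h3 (by positivity)
        _ = C * (|Real.log C| + 2) * Real.exp (-(γ / 2) * s) := by ring

theorem stableIntegrable_of_abs_le_exp {α β C γ : ℝ} (hα : 0 < α) (hC : 0 < C) (hγ : 0 < γ)
    {f : ℝ → ℝ} (hf : Measurable f) (hle : ∀ u ≥ 0, |f u| ≤ C * Real.exp (-γ * u)) :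
    StableIntegrable α (volume.restrict (Set.Ioi (0 : ℝ))) (fun _ => β) f := by
  have h := stableIntegrable_const_mul_exp (β := β) hα hC hγ
  rw [stableIntegrable_iff_integrable_admissibleBound] at *
  refine ⟨hf, (h.2.const_mul (1 + |β|)).mono' ?_ ?_⟩
  · exact ((continuous_admissibleBound hα).measurable.comp hf).aestronglyMeasurable
  · filter_upwards [ae_restrict_mem measurableSet_Ioi] with s hs
    rw [Real.norm_of_nonneg (admissibleBound_nonneg _)]
    exact admissibleBound_mono hα ((hle s (le_of_lt hs)).trans (le_abs_self _))

theorem stableIntegrable_controlMeasure_iff {α β : ℝ} (hκ : 0 < κ) {f : ℝ → ℝ} (hf : Measurable f) :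
    StableIntegrable α (controlMeasure κ) (fun _ => β) (fun s : ℝ≥0 => f s) ↔
      StableIntegrable α (volume.restrict (Set.Ioi (0 : ℝ))) (fun _ => β) f := by
  rw [stableIntegrable_iff_integrable_admissibleBound,
    stableIntegrable_iff_integrable_admissibleBound,
    integrable_controlMeasure_iff hκ (fun s => admissibleBound α β (f s))]
  exact ⟨fun h => ⟨hf, h.2⟩, fun h => ⟨by fun_prop, h.2⟩⟩

end ControlMeasure

noncomputable section

/-! ### Joint laws by projections, and stability of the vector. -/

section VectorLaw

variable {n : ℕ} {α κ : ℝ} {β : Fin n → ℝ} {f : Fin n → Fin n → ℝ → ℝ} {T : Set ℝ}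
  {c : Fin n → ℝ} {ν : Measure (Fin n → ℝ)}

/-- The logarithm of the characteristic function of `c + ∑ⱼ ∫_T f(·, j) dMⱼ` at `w`, for control
measure `κ · Lebesgue`. -/
def vectorExponent (α κ : ℝ) (β : Fin n → ℝ) (f : Fin n → Fin n → ℝ → ℝ) (T : Set ℝ)
    (c w : Fin n → ℝ) : ℂ :=
  Complex.I * ((w ⬝ᵥ c : ℝ) : ℂ)
    + ∑ j, κ * ∫ s in T, levyExponent α (β j) (∑ i, w i * f i j s)

/-- `ν` is the law of `c + ∑ⱼ ∫_T f(·, j) dMⱼ`, in terms of the characteristic functions of its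
one-dimensional projections. -/
def HasStableCharFun (α κ : ℝ) (β : Fin n → ℝ) (f : Fin n → Fin n → ℝ → ℝ) (T : Set ℝ)
    (c : Fin n → ℝ) (ν : Measure (Fin n → ℝ)) : Prop :=
  ∀ w : Fin n → ℝ,
    charFun (ν.map fun v => w ⬝ᵥ v) 1 = Complex.exp (vectorExponent α κ β f T c w)

theorem measurable_dotProduct_left (w : Fin n → ℝ) : Measurable fun v : Fin n → ℝ => w ⬝ᵥ v := by
  unfold dotProduct; fun_prop

/-- Cramér–Wold: every linear functional on ℝⁿ is a dot product. Evaluation at 1 suffices because w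
is arbitrary. -/
theorem ext_of_charFun_dotProduct {μ ν : Measure (Fin n → ℝ)} [IsFiniteMeasure μ]
    [IsFiniteMeasure ν]
    (h : ∀ w : Fin n → ℝ,
      charFun (μ.map fun v => w ⬝ᵥ v) 1 = charFun (ν.map fun v => w ⬝ᵥ v) 1) : μ = ν := by
  refine Measure.ext_of_charFunDual (funext fun L => ?_)
  have hL : (L : (Fin n → ℝ) → ℝ) = fun v => (fun i => L (Pi.single i 1)) ⬝ᵥ v := by
    ext v
    have := LinearMap.pi_apply_eq_sum_univ (L : (Fin n → ℝ) →ₗ[ℝ] ℝ) v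
    simp only [ContinuousLinearMap.coe_coe, smul_eq_mul] at this
    rw [this, dotProduct]
    refine Finset.sum_congr rfl fun i _ => ?_
    rw [mul_comm]
    congr 2
    ext j
    simp [Pi.single_apply, eq_comm]
  rw [charFunDual_eq_charFun_map_one, charFunDual_eq_charFun_map_one, hL]
  exact h _

theorem charFun_map_dotProduct_const_add [IsFiniteMeasure ν] (w c : Fin n → ℝ) :
    charFun ((ν.map fun v => c + v).map fun v => w ⬝ᵥ v) 1
      = Complex.exp (Complex.I * ((w ⬝ᵥ c : ℝ) : ℂ)) * charFun (ν.map fun v => w ⬝ᵥ v) 1 := by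
  rw [Measure.map_map (measurable_dotProduct_left w) (by fun_prop)]
  have : (fun v => w ⬝ᵥ v) ∘ (fun v => c + v) = (fun x => w ⬝ᵥ c + x) ∘ fun v => w ⬝ᵥ v := by
    ext v; simp [dotProduct_add]
  rw [this, ← Measure.map_map (by fun_prop) (measurable_dotProduct_left w), charFun_map_const_add]
  simp [mul_comm]

theorem charFun_map_dotProduct_smul [IsFiniteMeasure ν] (w : Fin n → ℝ) (a : ℝ) :
    charFun ((ν.map fun v => a • v).map fun v => w ⬝ᵥ v) 1
      = charFun (ν.map fun v => (a • w) ⬝ᵥ v) 1 := by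
  rw [Measure.map_map (measurable_dotProduct_left w) (by fun_prop)]
  congr 2
  ext v
  simp

theorem charFun_map_dotProduct_prod [IsProbabilityMeasure ν] (w : Fin n → ℝ) (a b : ℝ) :
    charFun (((ν.prod ν).map fun p => a • p.1 + b • p.2).map fun v => w ⬝ᵥ v) 1
      = charFun (ν.map fun v => (a • w) ⬝ᵥ v) 1 * charFun (ν.map fun v => (b • w) ⬝ᵥ v) 1 := by
  have hm := measurable_dotProduct_left (n := n)
  rw [Measure.map_map (hm w) (by fun_prop)]
  have : (fun v => w ⬝ᵥ v) ∘ (fun p : (Fin n → ℝ) × (Fin n → ℝ) => a • p.1 + b • p.2)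
      = (fun q : ℝ × ℝ => q.1 + q.2) ∘ Prod.map (fun v => (a • w) ⬝ᵥ v) fun v => (b • w) ⬝ᵥ v := by
    ext p; simp
  rw [this, ← Measure.map_map (by fun_prop) ((hm _).prodMap (hm _)),
    ← Measure.map_prod_map _ _ (hm _) (hm _), ← Measure.conv, charFun_conv]

/-- The drift by which the Lévy exponent fails to be homogeneous. -/
def scalingDrift (α β a : ℝ) : ℝ := if α = 1 then -(2 / Real.pi) * β * (a * Real.log a) else 0

/-- The analytic source of stability: homogeneity of degree α, except that for α = 1 the splitting
of log(a|u|) leaves a term linear in u. -/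
theorem levyExponent_mul {β a : ℝ} (ha : 0 < a) (u : ℝ) :
    levyExponent α β (a * u)
      = ((a ^ α : ℝ) : ℂ) * levyExponent α β u
        + Complex.I * ((scalingDrift α β a * u : ℝ) : ℂ) := by
  by_cases h1 : α = 1
  · subst h1
    rw [levyExponent_one, levyExponent_one, scalingDrift, if_pos rfl, abs_mul, abs_of_pos ha,
      Real.rpow_one]
    rcases eq_or_ne u 0 with rfl | hu
    · simp
    · rw [Real.log_mul ha.ne' (abs_ne_zero.2 hu)]
      push_cast; ring
  · rw [levyExponent_of_ne_one h1, levyExponent_of_ne_one h1, scalingDrift, if_neg h1, abs_mul,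
      Real.mul_rpow (abs_nonneg _) (abs_nonneg _), signedPow_mul, abs_of_pos ha]
    have : signedPow a α = a ^ α := by simp [signedPow, Real.sign_of_pos ha, abs_of_pos ha]
    rw [this]
    push_cast; ring

/-- Skewness 1 imposes the strongest admissibility condition, so it is verified once and specialised
to each βⱼ. -/
theorem StableIntegrable.change_skew {B : Type*} [MeasurableSpace B] {m : Measure B} {g : B → ℝ}
    (hg : StableIntegrable α m (fun _ => 1) g) (b : ℝ) : StableIntegrable α m (fun _ => b) g :=
  ⟨hg.measurable, hg.integrable_rpow, fun h => by
    simpa using (hg.integrable_log h).const_mul b⟩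

theorem StableIntegrable.mono_measure {B : Type*} [MeasurableSpace B] {m m' : Measure B} {b : ℝ}
    {g : B → ℝ} (hg : StableIntegrable α m (fun _ => b) g) (h : m' ≤ m) :
    StableIntegrable α m' (fun _ => b) g :=
  ⟨hg.measurable, hg.integrable_rpow.mono_measure h, fun ha => (hg.integrable_log ha).mono_measure h⟩

theorem StableIntegrable.finsetSum {B ι : Type*} [MeasurableSpace B] {m : Measure B} {b : ℝ}
    (hα : 0 < α) (s : Finset ι) (w : ι → ℝ) {g : ι → B → ℝ}
    (hg : ∀ i ∈ s, StableIntegrable α m (fun _ => b) (g i)) :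
    StableIntegrable α m (fun _ => b) (fun x => ∑ i ∈ s, w i * g i x) := by
  classical
  induction s using Finset.induction with
  | empty =>
    rw [stableIntegrable_iff_integrable_admissibleBound]
    simp [admissibleBound, Real.zero_rpow hα.ne', measurable_const]
  | insert i s hi ih =>
    simp_rw [Finset.sum_insert hi]
    exact ((hg i (by simp)).const_mul hα _).add hα (ih fun j hj => hg j (by simp [hj]))

theorem StableIntegrable.integrable_of_eq_one {B : Type*} [MeasurableSpace B] {m : Measure B}
    {b : ℝ} {g : B → ℝ} (hg : StableIntegrable α m (fun _ => b) g) (h1 : α = 1) :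
    Integrable g m := by
  have := hg.integrable_rpow
  simp only [h1, Real.rpow_one] at this
  exact (integrable_norm_iff hg.measurable.aestronglyMeasurable).1 this

theorem StableIntegrable.integral_levyExponent_mul (hα : 0 < α) {B : Type*} [MeasurableSpace B]
    {m : Measure B} {b a : ℝ} {g : B → ℝ} (hg : StableIntegrable α m (fun _ => b) g) (ha : 0 < a) :
    ∫ x, levyExponent α b (a * g x) ∂m
      = ((a ^ α : ℝ) : ℂ) * ∫ x, levyExponent α b (g x) ∂m
        + Complex.I * ((scalingDrift α b a * ∫ x, g x ∂m : ℝ) : ℂ) := by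
  simp_rw [levyExponent_mul ha]
  rw [integral_add ((hg.integrable_levyExponent hα).const_mul _), integral_const_mul,
    integral_const_mul, integral_complex_ofReal, integral_const_mul]
  by_cases h1 : α = 1
  · exact (((hg.integrable_of_eq_one h1).const_mul _).ofReal).const_mul _
  · simp [scalingDrift, h1]

/-- The drifts combine into a single vector paired with w, which can later be moved into the
translation d. The part from c is split off since it scales by a and not by a^α. -/
theorem vectorExponent_smul (hα : 0 < α)
    (hf : ∀ i j, StableIntegrable α (volume.restrict T) (fun _ => 1) (f i j)) {a : ℝ} (ha : 0 < a)
    (w : Fin n → ℝ) :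
    vectorExponent α κ β f T c (a • w)
      = ((a ^ α : ℝ) : ℂ) * (vectorExponent α κ β f T c w - Complex.I * ((w ⬝ᵥ c : ℝ) : ℂ))
        + Complex.I * ((a * (w ⬝ᵥ c)
          + w ⬝ᵥ fun i => ∑ j, κ * scalingDrift α (β j) a * ∫ s in T, f i j s : ℝ) : ℂ) := by
  have hj : ∀ j, ∫ s in T, levyExponent α (β j) (∑ i, (a • w) i * f i j s)
      = ((a ^ α : ℝ) : ℂ) * (∫ s in T, levyExponent α (β j) (∑ i, w i * f i j s))
        + Complex.I * ((scalingDrift α (β j) a * ∑ i, w i * ∫ s in T, f i j s : ℝ) : ℂ) := by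
    intro j
    have h1 := (StableIntegrable.finsetSum hα Finset.univ w
      fun i _ => (hf i j).change_skew (β j)).integral_levyExponent_mul hα ha
    simp only [Pi.smul_apply, smul_eq_mul, mul_assoc, ← Finset.mul_sum]
    rw [h1]
    congr 3
    -- Admissibility gives integrability of the kernels when α = 1; otherwise the drift coefficient
    -- is 0 and none is needed.
    by_cases hα1 : α = 1
    · rw [integral_finsetSum _ fun i _ => ((hf i j).integrable_of_eq_one hα1).const_mul _]
      simp_rw [integral_const_mul]
    · simp [scalingDrift, hα1]
  have hd : (w ⬝ᵥ fun i => ∑ j, κ * scalingDrift α (β j) a * ∫ s in T, f i j s)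
      = ∑ j, κ * (scalingDrift α (β j) a * ∑ i, w i * ∫ s in T, f i j s) := by
    simp only [dotProduct, Finset.mul_sum]
    rw [Finset.sum_comm]
    exact Finset.sum_congr rfl fun j _ => Finset.sum_congr rfl fun i _ => by ring
  rw [hd, vectorExponent, vectorExponent]
  simp_rw [hj]
  rw [smul_dotProduct, smul_eq_mul]
  push_cast
  simp only [mul_add, Finset.sum_add_distrib, Finset.mul_sum, add_sub_cancel_left]
  rw [← add_assoc, add_comm (Complex.I * _) (∑ _, _), add_assoc]
  congr 1
  · exact Finset.sum_congr rfl fun j _ => by ring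
  · congr 1
    refine Finset.sum_congr rfl fun j _ => Finset.sum_congr rfl fun i _ => by ring

theorem HasStableCharFun.isStableVectorLaw [IsProbabilityMeasure ν] (hα : 0 < α)
    (hf : ∀ i j, StableIntegrable α (volume.restrict T) (fun _ => 1) (f i j))
    (hν : HasStableCharFun α κ β f T c ν) : IsStableVectorLaw α ν := by
  refine ⟨inferInstance, fun a b ha hb => ?_⟩
  set r := (a ^ α + b ^ α) ^ (1 / α) with hr
  have hab : 0 < a ^ α + b ^ α := by positivity
  have hr0 : 0 < r := Real.rpow_pos_of_pos hab _
  have hrα : r ^ α = a ^ α + b ^ α := by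
    rw [hr, ← Real.rpow_mul hab.le, one_div_mul_cancel hα.ne', Real.rpow_one]
  let e : ℝ → Fin n → ℝ := fun a i => ∑ j, κ * scalingDrift α (β j) a * ∫ s in T, f i j s
  -- This d balances the linear terms: (a + b)c + e(a) + e(b) on the left against rc + e(r) on the
  -- right.
  refine ⟨(a + b - r) • c + (e a + e b - e r), ?_⟩
  have hmeas1 : Measurable fun p : (Fin n → ℝ) × (Fin n → ℝ) => a • p.1 + b • p.2 := by fun_prop
  have := Measure.isProbabilityMeasure_map (μ := ν.prod ν) hmeas1.aemeasurable
  have hmap : (ν.map fun v => r • v + ((a + b - r) • c + (e a + e b - e r)))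
      = (ν.map fun v => r • v).map fun v => ((a + b - r) • c + (e a + e b - e r)) + v := by
    rw [Measure.map_map (by fun_prop) (by fun_prop)]
    congr 1
    ext v
    simp [add_comm]
  have hmeas2 : Measurable fun v : Fin n → ℝ => r • v := by fun_prop
  have := Measure.isProbabilityMeasure_map (μ := ν) hmeas2.aemeasurable
  rw [hmap]
  refine ext_of_charFun_dotProduct fun w => ?_
  rw [charFun_map_dotProduct_prod, charFun_map_dotProduct_const_add, charFun_map_dotProduct_smul,
    hν, hν, hν, ← Complex.exp_add, ← Complex.exp_add, vectorExponent_smul hα hf ha,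
    vectorExponent_smul hα hf hb, vectorExponent_smul hα hf hr0, hrα]
  congr 1
  simp only [dotProduct_add, dotProduct_sub, dotProduct_smul, smul_eq_mul, e]
  push_cast
  ring

end VectorLaw

end

/-! ### Scale, skewness and shift of the components. -/

section ComponentLaw

variable {n : ℕ} {α κ : ℝ} {β : Fin n → ℝ} {T : Set ℝ}

theorem StableIntegrable.integrable_signedPow (hα : 0 < α) {B : Type*} [MeasurableSpace B]
    {m : Measure B} {b : ℝ} {g : B → ℝ} (hg : StableIntegrable α m (fun _ => b) g) :
    Integrable (fun x => signedPow (g x) α) m :=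
  hg.integrable_rpow.mono' ((continuous_signedPow hα).measurable.comp
    hg.measurable).aestronglyMeasurable (ae_of_all _ fun _ => (abs_signedPow hα _).le)

theorem abs_integral_signedPow_le (hα : 0 < α) {B : Type*} [MeasurableSpace B]
    {m : Measure B} (g : B → ℝ) : |∫ x, signedPow (g x) α ∂m| ≤ ∫ x, |g x| ^ α ∂m :=
  (norm_integral_le_integral_norm fun x => signedPow (g x) α).trans_eq
    (integral_congr_ae (ae_of_all _ fun x => abs_signedPow hα (g x)))

variable {f : Fin n → ℝ → ℝ}

theorem scalePow_nonneg (hκ : 0 < κ) : 0 ≤ scalePow α κ f T :=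
  Finset.sum_nonneg fun _ _ => mul_nonneg hκ.le (integral_nonneg fun _ => by positivity)

/-- Besides keeping the skewness in [-1, 1], this forces the numerator to vanish when σ = 0, so the
quotient by zero does no harm. -/
theorem abs_skew_numerator_le (hα : 0 < α) (hκ : 0 < κ) (hβ : ∀ j, β j ∈ Set.Icc (-1 : ℝ) 1) :
    |∑ j, β j * (κ * ∫ s in T, signedPow (f j s) α)| ≤ scalePow α κ f T := by
  refine (Finset.abs_sum_le_sum_abs _ _).trans (Finset.sum_le_sum fun j _ => ?_)
  rw [abs_mul, abs_mul, abs_of_pos hκ]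
  have h1 : |β j| ≤ 1 := abs_le.2 (hβ j)
  have h2 := mul_le_mul_of_nonneg_left
    (abs_integral_signedPow_le hα (m := volume.restrict T) (f j)) hκ.le
  exact (mul_le_of_le_one_left (by positivity) h1).trans h2

theorem skewParam_mul_scalePow (hα : 0 < α) (hκ : 0 < κ) (hβ : ∀ j, β j ∈ Set.Icc (-1 : ℝ) 1) :
    skewParam α κ β f T * scalePow α κ f T = ∑ j, β j * (κ * ∫ s in T, signedPow (f j s) α) := by
  rcases eq_or_ne (scalePow α κ f T) 0 with h | h
  · have h1 := abs_skew_numerator_le (f := f) (T := T) hα hκ hβ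
    rw [h] at h1 ⊢
    rw [mul_zero, abs_nonpos_iff.1 h1]
  · exact div_mul_cancel₀ _ h

theorem abs_skewParam_le (hα : 0 < α) (hκ : 0 < κ) (hβ : ∀ j, β j ∈ Set.Icc (-1 : ℝ) 1) :
    |skewParam α κ β f T| ≤ 1 := by
  rw [skewParam, abs_div, abs_of_nonneg (scalePow_nonneg hκ)]
  exact div_le_one_of_le₀ (abs_skew_numerator_le hα hκ hβ) (scalePow_nonneg hκ)

/-- Multiplicativity of |·|^α and of the signed power separates θ from the kernel. For α = 1,
log|θf| = log|θ| + log|f|: the first summand feeds the skewness, the second the shift. -/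
theorem sum_integral_levyExponent (hα : 0 < α) (hκ : 0 < κ) (hβ : ∀ j, β j ∈ Set.Icc (-1 : ℝ) 1)
    (hf : ∀ j, StableIntegrable α (volume.restrict T) (fun _ => 1) (f j)) (θ : ℝ) :
    ∑ j, κ * ∫ s in T, levyExponent α (β j) (θ * f j s)
      = (scalePow α κ f T : ℂ) * levyExponent α (skewParam α κ β f T) θ
        + Complex.I * ((shiftParam α κ β f T : ℝ) : ℂ) * (θ : ℂ) := by
  have hskew := skewParam_mul_scalePow (f := f) (T := T) hα hκ hβ
  by_cases h1 : α = 1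
  · subst h1
    have hsp : ∀ u : ℝ, signedPow u 1 = u := fun u => by simp [signedPow_eq_mul_rpow]
    have hj : ∀ j, ∫ s in T, levyExponent 1 (β j) (θ * f j s)
        = (((-|θ| * ∫ s in T, |f j s| ^ (1 : ℝ)) : ℝ) : ℂ)
          + Complex.I * ((-(2 / Real.pi) * β j * (θ * Real.log |θ| * (∫ s in T, f j s)
            + θ * ∫ s in T, f j s * Real.log |f j s|) : ℝ) : ℂ) := by
      intro j
      have hi1 := (hf j).integrable_rpow
      have hi2 := (hf j).integrable_of_eq_one rfl
      have hi3 : IntegrableOn (fun s => f j s * Real.log |f j s|) T := by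
        have h := (hf j).integrable_log rfl
        simp only [one_mul] at h
        exact h
      have hpt : ∀ s, levyExponent 1 (β j) (θ * f j s)
          = ((-|θ| * |f j s| ^ (1 : ℝ) : ℝ) : ℂ) + Complex.I * ((-(2 / Real.pi) * β j *
            (θ * Real.log |θ| * f j s + θ * (f j s * Real.log |f j s|)) : ℝ) : ℂ) := by
        intro s
        rw [levyExponent_one, abs_mul, Real.rpow_one]
        rcases eq_or_ne θ 0 with rfl | hθ
        · simp
        rcases eq_or_ne (f j s) 0 with hu | hu
        · simp [hu]
        rw [Real.log_mul (abs_ne_zero.2 hθ) (abs_ne_zero.2 hu)]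
        push_cast; ring
      have hi4 := ((hi2.const_mul (θ * Real.log |θ|)).add (hi3.const_mul θ))
      simp_rw [hpt]
      rw [integral_add (hi1.const_mul _).ofReal ((hi4.const_mul _).ofReal.const_mul _),
        integral_const_mul, integral_complex_ofReal, integral_complex_ofReal, integral_const_mul,
        integral_const_mul, integral_add (hi2.const_mul _) (hi3.const_mul _), integral_const_mul,
        integral_const_mul]
    simp_rw [hsp] at hskew
    rw [levyExponent_one, shiftParam, if_pos rfl]
    have hR : -(2 / Real.pi) * (skewParam 1 κ β f T * scalePow 1 κ f T) * (θ * Real.log |θ|)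
        + (-(2 / Real.pi) * ∑ j, β j * (κ * ∫ s in T, f j s * Real.log |f j s|)) * θ
        = ∑ j, κ * (-(2 / Real.pi) * β j * (θ * Real.log |θ| * (∫ s in T, f j s)
            + θ * ∫ s in T, f j s * Real.log |f j s|)) := by
      rw [hskew, Finset.mul_sum, Finset.mul_sum, Finset.sum_mul, Finset.sum_mul,
        ← Finset.sum_add_distrib]
      exact Finset.sum_congr rfl fun j _ => by ring
    have hS : ∑ j, κ * (-|θ| * ∫ s in T, |f j s| ^ (1 : ℝ)) = -|θ| * scalePow 1 κ f T := by
      rw [scalePow, Finset.mul_sum]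
      exact Finset.sum_congr rfl fun j _ => by ring
    have hL : ∑ j, (κ : ℂ) * ∫ s in T, levyExponent 1 (β j) (θ * f j s)
        = ((∑ j, κ * (-|θ| * ∫ s in T, |f j s| ^ (1 : ℝ)) : ℝ) : ℂ)
          + Complex.I * ((∑ j, κ * (-(2 / Real.pi) * β j * (θ * Real.log |θ| * (∫ s in T, f j s)
            + θ * ∫ s in T, f j s * Real.log |f j s|)) : ℝ) : ℂ) := by
      rw [Complex.ofReal_sum, Complex.ofReal_sum, Finset.mul_sum, ← Finset.sum_add_distrib]
      refine Finset.sum_congr rfl fun j _ => ?_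
      rw [hj]
      push_cast; ring
    rw [hL, hS, ← hR]
    push_cast; ring
  · have hj : ∀ j, ∫ s in T, levyExponent α (β j) (θ * f j s)
        = (((-|θ| ^ α * ∫ s in T, |f j s| ^ α) : ℝ) : ℂ)
          + Complex.I * ((β j * Real.tan (Real.pi * α / 2) * signedPow θ α *
            ∫ s in T, signedPow (f j s) α : ℝ) : ℂ) := by
      intro j
      have hi1 := (hf j).integrable_rpow
      have hi2 := (hf j).integrable_signedPow hα
      have hpt : ∀ s, levyExponent α (β j) (θ * f j s)
          = ((-|θ| ^ α * |f j s| ^ α : ℝ) : ℂ) + Complex.I *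
            ((β j * Real.tan (Real.pi * α / 2) * signedPow θ α * signedPow (f j s) α : ℝ) : ℂ) := by
        intro s
        rw [levyExponent_of_ne_one h1, abs_mul, Real.mul_rpow (abs_nonneg _) (abs_nonneg _),
          signedPow_mul]
        push_cast; ring
      simp_rw [hpt]
      rw [integral_add (hi1.const_mul _).ofReal ((hi2.const_mul _).ofReal.const_mul _),
        integral_const_mul, integral_complex_ofReal, integral_complex_ofReal, integral_const_mul,
        integral_const_mul]
    rw [levyExponent_of_ne_one h1, shiftParam, if_neg h1]
    have hR : (skewParam α κ β f T * scalePow α κ f T) * Real.tan (Real.pi * α / 2) * signedPow θ α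
        = ∑ j, κ * (β j * Real.tan (Real.pi * α / 2) * signedPow θ α *
            ∫ s in T, signedPow (f j s) α) := by
      rw [hskew, Finset.sum_mul, Finset.sum_mul]
      exact Finset.sum_congr rfl fun j _ => by ring
    have hS : ∑ j, κ * (-|θ| ^ α * ∫ s in T, |f j s| ^ α) = -|θ| ^ α * scalePow α κ f T := by
      rw [scalePow, Finset.mul_sum]
      exact Finset.sum_congr rfl fun j _ => by ring
    have hL : ∑ j, (κ : ℂ) * ∫ s in T, levyExponent α (β j) (θ * f j s)
        = ((∑ j, κ * (-|θ| ^ α * ∫ s in T, |f j s| ^ α) : ℝ) : ℂ)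
          + Complex.I * ((∑ j, κ * (β j * Real.tan (Real.pi * α / 2) * signedPow θ α *
            ∫ s in T, signedPow (f j s) α) : ℝ) : ℂ) := by
      rw [Complex.ofReal_sum, Complex.ofReal_sum, Finset.mul_sum, ← Finset.sum_add_distrib]
      refine Finset.sum_congr rfl fun j _ => ?_
      rw [hj]
      push_cast; ring
    rw [hL, hS, ← hR]
    push_cast; ring

variable {F : Fin n → Fin n → ℝ → ℝ} {c : Fin n → ℝ} {ν : Measure (Fin n → ℝ)}

theorem HasStableCharFun.isStableLaw_map [IsProbabilityMeasure ν] (hα : 0 < α) (hα₂ : α ≤ 2)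
    (hκ : 0 < κ) (hβ : ∀ j, β j ∈ Set.Icc (-1 : ℝ) 1)
    (hF : ∀ i j, StableIntegrable α (volume.restrict T) (fun _ => 1) (F i j))
    (hν : HasStableCharFun α κ β F T c ν) (l : Fin n) :
    IsStableLaw α (scalePow α κ (F l) T ^ (1 / α)) (skewParam α κ β (F l) T)
      (c l + shiftParam α κ β (F l) T) (ν.map fun v => v l) := by
  have hmeas : Measurable fun v : Fin n → ℝ => v l := measurable_pi_apply l
  have hskew := abs_le.1 (abs_skewParam_le (f := F l) (T := T) hα hκ hβ)
  refine ⟨Measure.isProbabilityMeasure_map hmeas.aemeasurable, hα, hα₂,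
    Real.rpow_nonneg (scalePow_nonneg hκ) _, hskew.1, hskew.2, fun θ => ?_⟩
  -- The component l at frequency θ is the projection along θ e_l.
  have h1 : charFun (ν.map fun v => v l) θ
      = charFun (ν.map fun v => Pi.single l θ ⬝ᵥ v) 1 := by
    have h2 : (fun v : Fin n → ℝ => Pi.single l θ ⬝ᵥ v) = (fun x => θ * x) ∘ fun v => v l := by
      ext v; simp
    rw [h2, ← Measure.map_map (by fun_prop) hmeas, charFun_map_mul, mul_one]
  have h3 : ∀ (j : Fin n) (s : ℝ), ∑ i, (Pi.single l θ : Fin n → ℝ) i * F i j s = θ * F l j s := by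
    intro j s
    exact single_dotProduct (fun i => F i j s) θ l
  rw [h1, hν, vectorExponent]
  simp_rw [h3]
  rw [sum_integral_levyExponent hα hκ hβ (hF l), ← Real.rpow_mul (scalePow_nonneg hκ),
    one_div_mul_cancel hα.ne', Real.rpow_one, single_dotProduct, levyExponent]
  congr 1
  push_cast; ring

end ComponentLaw

/-! ### Convergence in distribution. -/

section Limit

variable {n : ℕ} {α κ : ℝ} {β : Fin n → ℝ} {F : Fin n → Fin n → ℝ → ℝ}

theorem tendsto_vectorExponent (hα : 0 < α)
    (hF : ∀ i j, StableIntegrable α (volume.restrict (Set.Ioi 0)) (fun _ => 1) (F i j))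
    {c : ℝ≥0 → Fin n → ℝ} (hc : Tendsto c atTop (𝓝 0)) (w : Fin n → ℝ) :
    Tendsto (fun t : ℝ≥0 => vectorExponent α κ β F (Set.Ioc 0 (t : ℝ)) (c t) w) atTop
      (𝓝 (vectorExponent α κ β F (Set.Ioi 0) 0 w)) := by
  refine Tendsto.add ?_ (tendsto_finsetSum _ fun j _ => Tendsto.const_mul _ ?_)
  · have h : Continuous fun v : Fin n → ℝ => Complex.I * ((w ⬝ᵥ v : ℝ) : ℂ) := by
      unfold dotProduct; fun_prop
    exact (h.tendsto 0).comp hc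
  · have hi := (StableIntegrable.finsetSum hα Finset.univ w
      fun i _ => (hF i j).change_skew (β j)).integrable_levyExponent hα
    have h := (intervalIntegral_tendsto_integral_Ioi (0 : ℝ) hi tendsto_id).comp
      (NNReal.tendsto_coe_atTop.2 tendsto_id)
    refine h.congr fun t => ?_
    simp only [Function.comp_apply, id]
    exact intervalIntegral.integral_of_le t.coe_nonneg

theorem HasStableCharFun.tendstoInDistribution {Ω : Type*} [MeasurableSpace Ω] {P : Measure Ω}
    [IsProbabilityMeasure P] (hα : 0 < α)
    (hF : ∀ i j, StableIntegrable α (volume.restrict (Set.Ioi 0)) (fun _ => 1) (F i j))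
    {c : ℝ≥0 → Fin n → ℝ} (hc : Tendsto c atTop (𝓝 0)) {y : ℝ≥0 → Ω → Fin n → ℝ}
    (hy : ∀ t, AEMeasurable (y t) P)
    (hlaw : ∀ t : ℝ≥0, HasStableCharFun α κ β F (Set.Ioc 0 (t : ℝ)) (c t) (P.map (y t)))
    {ν : Measure (Fin n → ℝ)} [IsProbabilityMeasure ν]
    (hν : HasStableCharFun α κ β F (Set.Ioi 0) 0 ν) :
    TendstoInDistribution y atTop (id : (Fin n → ℝ) → Fin n → ℝ) (fun _ => P) ν := by
  -- Characteristic functions use an inner product, so the continuity theorem is applied on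
  -- `EuclideanSpace` and the result is carried back by a continuous map.
  have hcf : ∀ (μ : Measure (Fin n → ℝ)) (w : EuclideanSpace ℝ (Fin n)),
      charFun (μ.map (WithLp.toLp 2)) w = charFun (μ.map fun v => w.ofLp ⬝ᵥ v) 1 := by
    intro μ w
    rw [charFun_apply, charFun_apply_real, integral_map (by fun_prop)
      (by fun_prop), integral_map (measurable_dotProduct_left _).aemeasurable (by fun_prop)]
    congr 1
    ext v
    simp [PiLp.inner_apply, dotProduct, mul_comm]
  have hE : TendstoInDistribution (fun t ω => (WithLp.toLp 2 (y t ω) : EuclideanSpace ℝ (Fin n)))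
      atTop (fun v => (WithLp.toLp 2 v : EuclideanSpace ℝ (Fin n))) (fun _ => P) ν := by
    refine ⟨fun t => by have := hy t; fun_prop, by fun_prop, ?_⟩
    refine tendsto_of_seq_tendsto fun u hu => ?_
    refine ProbabilityMeasure.tendsto_of_tendsto_charFun (E := EuclideanSpace ℝ (Fin n))
      fun w => ?_
    have h1 : ∀ t, P.map (fun ω => (WithLp.toLp 2 (y t ω) : EuclideanSpace ℝ (Fin n)))
        = (P.map (y t)).map (WithLp.toLp 2) := fun t =>
      (AEMeasurable.map_map_of_aemeasurable (by fun_prop) (hy t)).symm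
    have h2 := (Complex.continuous_exp.tendsto _).comp
      ((tendsto_vectorExponent (β := β) (κ := κ) hα hF hc w.ofLp).comp hu)
    rw [← hν, ← hcf] at h2
    refine h2.congr fun k => ?_
    change _ = charFun (P.map fun ω => (WithLp.toLp 2 (y (u k) ω) : EuclideanSpace ℝ (Fin n))) w
    rw [h1, hcf, hlaw]
    rfl
  exact hE.continuous_comp (g := fun v : EuclideanSpace ℝ (Fin n) => v.ofLp) (by fun_prop)

end Limit

/-! ### Convolutions of matrix kernels with the noise. -/

section NoiseConvolution

variable {Ω : Type*} [MeasurableSpace Ω] {P : Measure Ω} {n : ℕ}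
  {α κ : ℝ} {β : Fin n → ℝ} {M : Fin n → Set ℝ≥0 → Ω → ℝ}

theorem convKernel_sum {ι : Type*} (s : Finset ι) (w : ι → ℝ) (h : ι → ℝ → ℝ) (t r : ℝ≥0) :
    convKernel (fun u => ∑ i ∈ s, w i * h i u) t r = ∑ i ∈ s, w i * convKernel (h i) t r := by
  simp only [convKernel, mul_ite, mul_zero]
  split_ifs <;> simp

theorem IsStableNoise.noiseConvExists [IsProbabilityMeasure P]
    (hα : 0 < α) (hκ : 0 < κ) (hM : IsStableNoise α κ β M P)
    {K : ℝ → Matrix (Fin n) (Fin n) ℝ} (hK : ∀ i j, Continuous fun u => K u i j) (t : ℝ≥0) :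
    NoiseConvExists α κ β M P K t := fun i j =>
  have h := stableIntegrable_convKernel (β := β j) hα hκ (hK i j) t
  ⟨h, (hM.isStableRandomMeasure j).exists_hasStableIntegral hα h⟩

theorem NoiseConvExists.hasStableIntegral {K : ℝ → Matrix (Fin n) (Fin n) ℝ} {t : ℝ≥0}
    (h : NoiseConvExists α κ β M P K t) (i j : Fin n) :
    HasStableIntegral α (controlMeasure κ) (fun _ => β j) (M j) P (convKernel (fun u => K u i j) t)
      (stableIntegral α (controlMeasure κ) (fun _ => β j) (M j) P
        (convKernel (fun u => K u i j) t)) :=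
  (h i j).2.choose_spec.stableIntegral

/-- Linearity of the integral in each column. The identity holds only almost surely, as each
`stableIntegral` is a chosen version. -/
theorem IsStableNoise.mulVec_noiseConv [IsProbabilityMeasure P]
    (hα : 0 < α) (hM : IsStableNoise α κ β M P)
    {K : ℝ → Matrix (Fin n) (Fin n) ℝ} {t : ℝ≥0} (hK : NoiseConvExists α κ β M P K t)
    (C : Matrix (Fin n) (Fin n) ℝ) :
    ∀ᵐ ω ∂P, C *ᵥ noiseConv α κ β M P K t ω = noiseConv α κ β M P (fun u => C * K u) t ω := by
  have h : ∀ i j, ∀ᵐ ω ∂P, ∑ k, C i k * stableIntegral α (controlMeasure κ) (fun _ => β j) (M j) P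
        (convKernel (fun u => K u k j) t) ω
      = stableIntegral α (controlMeasure κ) (fun _ => β j) (M j) P
        (convKernel (fun u => (C * K u) i j) t) ω := by
    intro i j
    have h1 := HasStableIntegral.finsetSum hα (hM.isStableRandomMeasure j) Finset.univ (C i)
      fun k _ => hK.hasStableIntegral k j
    have h2 : (fun s => ∑ k, C i k * convKernel (fun u => K u k j) t s)
        = convKernel (fun u => (C * K u) i j) t := by
      ext s
      rw [← convKernel_sum]
      rfl
    rw [h2] at h1
    exact h1.ae_eq hα (hM.isStableRandomMeasure j) h1.stableIntegral
  filter_upwards [ae_all_iff.2 fun i => ae_all_iff.2 (h i)] with ω hω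
  ext i
  simp only [mulVec, dotProduct, noiseConv, Finset.mul_sum]
  rw [Finset.sum_comm]
  exact Finset.sum_congr rfl fun j _ => hω i j

/-- The coordinates share the same noises; projecting along w and regrouping by j leaves independent
summands. -/
theorem IsStableNoise.charFun_map_vector [IsProbabilityMeasure P]
    (hα : 0 < α) (hM : IsStableNoise α κ β M P)
    {f : Fin n → Fin n → ℝ≥0 → ℝ} {X : Fin n → Fin n → Ω → ℝ}
    (hX : ∀ i j, HasStableIntegral α (controlMeasure κ) (fun _ => β j) (M j) P (f i j) (X i j))
    (w : Fin n → ℝ) :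
    charFun ((P.map fun ω i => ∑ j, X i j ω).map fun v => w ⬝ᵥ v) 1
      = Complex.exp (∑ j, ∫ s, levyExponent α (β j) (∑ i, w i * f i j s) ∂(controlMeasure κ)) := by
  rw [← hM.charFun_map_sum hα fun j => HasStableIntegral.finsetSum hα (hM.isStableRandomMeasure j)
    Finset.univ w fun i _ => hX i j]
  have hm : AEMeasurable (fun ω i => ∑ j, X i j ω) P :=
    aemeasurable_pi_lambda _ fun i => Finset.aemeasurable_fun_sum _ fun j _ => (hX i j).1
  rw [AEMeasurable.map_map_of_aemeasurable (measurable_dotProduct_left w).aemeasurable hm]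
  congr 2
  ext ω
  simp only [Function.comp_apply, dotProduct, Finset.sum_apply, Finset.mul_sum]
  exact Finset.sum_comm

theorem NoiseConvExists.aemeasurable {K : ℝ → Matrix (Fin n) (Fin n) ℝ} {t : ℝ≥0}
    (h : NoiseConvExists α κ β M P K t) : AEMeasurable (noiseConv α κ β M P K t) P :=
  aemeasurable_pi_lambda _ fun i => Finset.aemeasurable_fun_sum _ fun j _ =>
    (h.hasStableIntegral i j).1

theorem IsStableNoise.hasStableCharFun_noiseConv [IsProbabilityMeasure P]
    (hα : 0 < α) (hκ : 0 < κ)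
    (hM : IsStableNoise α κ β M P) {K : ℝ → Matrix (Fin n) (Fin n) ℝ} {t : ℝ≥0}
    (hK : NoiseConvExists α κ β M P K t) (c : Fin n → ℝ) :
    HasStableCharFun α κ β (fun i j u => K u i j) (Set.Ioc 0 (t : ℝ)) c
      (P.map fun ω => c + noiseConv α κ β M P K t ω) := by
  intro w
  have hm := hK.aemeasurable
  have := Measure.isProbabilityMeasure_map hm
  have h1 : P.map (fun ω => c + noiseConv α κ β M P K t ω)
      = (P.map (noiseConv α κ β M P K t)).map fun v => c + v :=
    (AEMeasurable.map_map_of_aemeasurable (by fun_prop) hm).symm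
  rw [h1, charFun_map_dotProduct_const_add, vectorExponent, Complex.exp_add]
  congr 1
  refine (hM.charFun_map_vector hα (fun i j => hK.hasStableIntegral i j) w).trans ?_
  congr 1
  refine Finset.sum_congr rfl fun j _ => ?_
  simp_rw [← convKernel_sum]
  exact integral_convKernel hκ (levyExponent_zero hα) _ t

/-- The law is realised by integrating F itself over the half-line against the given noise, so no
tightness argument is needed. -/
theorem IsStableNoise.exists_hasStableCharFun [IsProbabilityMeasure P]
    (hα : 0 < α) (hκ : 0 < κ)
    (hM : IsStableNoise α κ β M P) {F : Fin n → Fin n → ℝ → ℝ}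
    (hF : ∀ i j, StableIntegrable α (volume.restrict (Set.Ioi 0)) (fun _ => 1) (F i j)) :
    ∃ ν : ProbabilityMeasure (Fin n → ℝ), HasStableCharFun α κ β F (Set.Ioi 0) 0 ν := by
  choose X hX using fun i j => (hM.isStableRandomMeasure j).exists_hasStableIntegral hα
    ((stableIntegrable_controlMeasure_iff hκ (hF i j).measurable).2 ((hF i j).change_skew (β j)))
  have hm : AEMeasurable (fun ω i => ∑ j, X i j ω) P :=
    aemeasurable_pi_lambda _ fun i => Finset.aemeasurable_fun_sum _ fun j _ => (hX i j).1
  refine ⟨⟨_, Measure.isProbabilityMeasure_map hm⟩, fun w => ?_⟩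
  rw [ProbabilityMeasure.coe_mk, hM.charFun_map_vector hα hX, vectorExponent]
  congr 1
  simp only [dotProduct_zero, Complex.ofReal_zero, mul_zero, zero_add]
  exact Finset.sum_congr rfl fun j _ =>
    integral_controlMeasure hκ fun s => levyExponent α (β j) (∑ i, w i * F i j s)

end NoiseConvolution

/-! ### The consensus network driven by stable noise. -/

theorem theorem1 {Ω : Type*} [MeasurableSpace Ω] (P : Measure Ω) [IsProbabilityMeasure P]
    {n : ℕ} (α κ : ℝ) (hα₀ : 0 < α) (hα₂ : α ≤ 2) (hκ : 0 < κ)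
    -- the network
    (G : SimpleGraph (Fin n)) (hG : G.Connected) (a : Fin n → Fin n → ℝ) (ha : IsCoupling G a)
    -- a spectral decomposition of its Laplacian, with eigenvalues in increasing order
    (Q : Matrix (Fin n) (Fin n) ℝ) (lam : Fin n → ℝ) (hQ : Qᵀ * Q = 1) (hlam : Monotone lam)
    (hL : laplacian a = Q * Matrix.diagonal lam * Qᵀ)
    -- the noise
    (β : Fin n → ℝ) (M : Fin n → Set ℝ≥0 → Ω → ℝ) (hM : IsStableNoise α κ β M P)
    -- the state and the output
    (x₀ : Fin n → ℝ) (x y : ℝ≥0 → Ω → Fin n → ℝ)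
    (hx : ∀ t : ℝ≥0, ∀ᵐ ω ∂P, x t ω =
      NormedSpace.exp (-(t : ℝ) • laplacian a) *ᵥ x₀
        + noiseConv α κ β M P (fun u => NormedSpace.exp (-u • laplacian a)) t ω)
    (hy : ∀ (t : ℝ≥0) (ω : Ω), y t ω = centering n *ᵥ x t ω) :
    -- the stable integrals exist
    (∀ t : ℝ≥0, NoiseConvExists α κ β M P (fun u => NormedSpace.exp (-u • laplacian a)) t ∧
      NoiseConvExists α κ β M P (fun u => Q * Phi lam u * Qᵀ) t) ∧
    -- the representation of the output
    (∀ t : ℝ≥0, ∀ᵐ ω ∂P, y t ω =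
      (Q * Phi lam t * Qᵀ) *ᵥ (centering n *ᵥ x₀)
        + noiseConv α κ β M P (fun u => Q * Phi lam u * Qᵀ) t ω) ∧
    -- the output is a stable vector at each time, and so is each of its components
    (∀ t : ℝ≥0, IsStableVectorLaw α (P.map (y t)) ∧
      ∀ l, IsStableLaw α
        (scalePow α κ (spectralFun Q lam l) (Set.Ioc 0 (t : ℝ)) ^ (1 / α))
        (skewParam α κ β (spectralFun Q lam l) (Set.Ioc 0 (t : ℝ)))
        (((Q * Phi lam t * Qᵀ) *ᵥ (centering n *ᵥ x₀)) l
          + shiftParam α κ β (spectralFun Q lam l) (Set.Ioc 0 (t : ℝ)))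
        (P.map (fun ω => y t ω l))) ∧
    -- the integrals in the limiting parameters converge
    (∀ l j, IntegrableOn (fun s => |spectralFun Q lam l j s| ^ α) (Set.Ioi 0) ∧
      (α = 1 → IntegrableOn
        (fun s => spectralFun Q lam l j s * Real.log |spectralFun Q lam l j s|) (Set.Ioi 0))) ∧
    -- the output converges in distribution, and the components of the limit have the stated laws
    ∃ ν : ProbabilityMeasure (Fin n → ℝ),
      TendstoInDistribution y atTop (id : (Fin n → ℝ) → Fin n → ℝ) (fun _ => P)
        (ν : Measure (Fin n → ℝ)) ∧
      ∀ l, IsStableLaw α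
        (scalePow α κ (spectralFun Q lam l) (Set.Ioi 0) ^ (1 / α))
        (skewParam α κ β (spectralFun Q lam l) (Set.Ioi 0))
        (shiftParam α κ β (spectralFun Q lam l) (Set.Ioi 0))
        ((ν : Measure (Fin n → ℝ)).map (fun v => v l)) := by
  have hβ : ∀ j, β j ∈ Set.Icc (-1 : ℝ) 1 := fun j => (hM.isStableRandomMeasure j).skew_mem 0
  have hΦ : ∀ u : ℝ, centering n * NormedSpace.exp (-u • laplacian a) = Q * Phi lam u * Qᵀ :=
    ha.centering_mul_exp hG hQ hlam hL
  have hentry : (fun i j u => (Q * Phi lam u * Qᵀ) i j) = spectralFun Q lam := by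
    ext i j u
    exact mul_Phi_mul_apply u i j
  have hexK : ∀ t, NoiseConvExists α κ β M P (fun u => NormedSpace.exp (-u • laplacian a)) t :=
    hM.noiseConvExists hα₀ hκ fun i j => by
      simp only [exp_neg_smul_laplacian hQ hL, Matrix.mul_apply]
      fun_prop
  have hexΦ : ∀ t, NoiseConvExists α κ β M P (fun u => Q * Phi lam u * Qᵀ) t :=
    hM.noiseConvExists hα₀ hκ fun i j => by
      simp only [mul_Phi_mul_apply]
      exact continuous_spectralFun i j
  obtain ⟨C, hC, γ, hγ, hdecay⟩ := exists_abs_spectralFun_le (Q := Q) (lam := lam)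
    fun _ hk => ha.lam_pos hG hQ hlam hL hk
  have hF : ∀ i j, StableIntegrable α (volume.restrict (Set.Ioi (0 : ℝ))) (fun _ => 1)
      (spectralFun Q lam i j) := fun i j =>
    stableIntegrable_of_abs_le_exp hα₀ hC hγ (continuous_spectralFun i j).measurable (hdecay i j)
  have hFt : ∀ (t : ℝ) (i j), StableIntegrable α (volume.restrict (Set.Ioc 0 t)) (fun _ => 1)
      (spectralFun Q lam i j) := fun t i j =>
    (hF i j).mono_measure (Measure.restrict_mono Set.Ioc_subset_Ioi_self le_rfl)
  have hrep : ∀ t : ℝ≥0, ∀ᵐ ω ∂P, y t ω = (Q * Phi lam t * Qᵀ) *ᵥ (centering n *ᵥ x₀)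
      + noiseConv α κ β M P (fun u => Q * Phi lam u * Qᵀ) t ω := by
    intro t
    have h := hM.mulVec_noiseConv hα₀ (hexK t) (centering n)
    simp_rw [hΦ] at h
    filter_upwards [hx t, h] with ω h1 h2
    -- The last rewrite absorbs the centering of x₀, because Q Φ Qᵀ already annihilates the
    -- constants.
    rw [hy, h1, mulVec_add, h2, mulVec_mulVec, hΦ, mulVec_mulVec,
      ha.mul_Phi_mul_centering hG hQ hlam hL]
  have hym : ∀ t, AEMeasurable (y t) P := fun t =>
    ((hexΦ t).aemeasurable.const_add _).congr ((hrep t).mono fun ω h => h.symm)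
  have hlaw : ∀ t : ℝ≥0, HasStableCharFun α κ β (spectralFun Q lam) (Set.Ioc 0 (t : ℝ))
      ((Q * Phi lam t * Qᵀ) *ᵥ (centering n *ᵥ x₀)) (P.map (y t)) := fun t => by
    rw [Measure.map_congr (hrep t), ← hentry]
    exact hM.hasStableCharFun_noiseConv hα₀ hκ (hexΦ t) _
  have hdrift : Tendsto (fun t : ℝ≥0 => (Q * Phi lam t * Qᵀ) *ᵥ (centering n *ᵥ x₀)) atTop
      (𝓝 0) := by
    rw [tendsto_pi_nhds]
    intro i
    have h : ∀ j, Tendsto (fun t : ℝ≥0 => (Q * Phi lam t * Qᵀ) i j) atTop (𝓝 0) := fun j => by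
      simp_rw [mul_Phi_mul_apply]
      refine squeeze_zero_norm (fun t : ℝ≥0 => hdecay i j t t.coe_nonneg) ?_
      have h1 : Tendsto (fun t : ℝ≥0 => γ * (t : ℝ)) atTop atTop :=
        (NNReal.tendsto_coe_atTop.2 tendsto_id).const_mul_atTop hγ
      simpa [Function.comp_def] using (Real.tendsto_exp_neg_atTop_nhds_zero.comp h1).const_mul C
    have h2 := tendsto_finsetSum Finset.univ fun j _ =>
      (h j).mul_const ((centering n *ᵥ x₀) j)
    simpa [mulVec, dotProduct] using h2
  obtain ⟨ν, hν⟩ := hM.exists_hasStableCharFun hα₀ hκ hF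
  refine ⟨fun t => ⟨hexK t, hexΦ t⟩, hrep, fun t => ?_, fun l j => ?_, ν, ?_, fun l => ?_⟩
  · have := Measure.isProbabilityMeasure_map (hym t)
    refine ⟨(hlaw t).isStableVectorLaw hα₀ (hFt t), fun l => ?_⟩
    have h := (hlaw t).isStableLaw_map hα₀ hα₂ hκ hβ (hFt t) l
    rwa [AEMeasurable.map_map_of_aemeasurable (measurable_pi_apply l).aemeasurable (hym t)] at h
  · refine ⟨(hF l j).integrable_rpow, fun h1 => ?_⟩
    have h := (hF l j).integrable_log h1
    simp only [one_mul] at h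
    exact h
  · exact HasStableCharFun.tendstoInDistribution hα₀ hF hdrift hym hlaw hν
  · simpa using hν.isStableLaw_map hα₀ hα₂ hκ hβ hF l
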